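/- Let $T>0$, let $d,k$ be positive integers and $\mathcal X=\{1,\dots,k\}$. Let $r:\mathcal X\to[0,\infty)$; for each $i\in\mathcal X$ let $\sigma(i)=(\sigma_{l,j}(i))$ be an invertible real $d\times d$ matrix and $a(i)=\sigma(i)\sigma(i)^{*}$; let $\Lambda=(\lambda_{ij})_{k\times k}$ be a transition rate matrix, i.e. $\lambda_{ij}\ge 0$ for $i\ne j$ and $\sum_{j}\lambda_{ij}=0$ for every $i$; and let $\mathcal K:(0,\infty)^d\to[0,\infty)$ be Lipschitz continuous. Consider the terminal-value problem $$\frac{\partial\phi}{\partial t}(t,s,i)+\mathbb L\phi(t,s,i)=0,\qquad (t,s,i)\in(0,T)\times(0,\infty)^d\times\mathcal X,$$ $$\phi(T,s,i)=\mathcal K(s),\qquad (s,i)\in(0,\infty)^d\times\mathcal X,$$ where $$\mathbb L\phi(t,s,i)=\Big(r(i)\sum_{l=1}^d s_l\frac{\partial\phi}{\partial s_l}+\frac12\sum_{l=1}^d\sum_{l'=1}^d a_{ll'}(i)s_ls_{l'}\frac{\partial^2\phi}{\partial s_l\partial s_{l'}}-r(i)\phi\Big)(t,s,i)+\sum_{j=1}^k\lambda_{ij}\phi(t,s,j).$$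 A classical solution is a function $\phi:(0,T]\times(0,\infty)^d\times\mathcal X\to\mathbb R$ satisfying both equations such that, for each $i\in\mathcal X$, $\phi(\cdot,\cdot,i)$ is continuous on $(0,T]\times(0,\infty)^d$ and the derivatives $\frac{\partial\phi}{\partial t}$, $\frac{\partial\phi}{\partial s_l}$, $\frac{\partial^2\phi}{\partial s_l\partial s_{l'}}$ $(1\le l,l'\le d)$ exist and are continuous on $(0,T)\times(0,\infty)^d$. Let $V$ be the class of functions $\phi$ such that each $\phi(\cdot,\cdot,i)$ is continuous on $(0,T)\times(0,\infty)^d$ and $$\sup_{(t,s,i)\in(0,T)\times(0,\infty)^d\times\mathcal X}\left|\frac{\phi(t,s,i)}{1+\|s\|_1}\right|<\infty,\qquad \|s\|_1=\sum_{l=1}^d|s_l|.$$ Then the terminal-value problem has exactly one classical solution in $V$. -/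

import Mathlib

open scoped NNReal

namespace RegimeSwitching

/-- The open positive orthant `(0, ∞)^d`. -/
def orthant (d : ℕ) : Set (Fin d → ℝ) := {s | ∀ l, 0 < s l}

/-- A transition rate matrix (generator) of a continuous-time Markov chain on `Fin k`. -/
structure IsRateMatrix {k : ℕ} (Λ : Matrix (Fin k) (Fin k) ℝ) : Prop where
  nonneg_of_ne : ∀ i j, i ≠ j → 0 ≤ Λ i j
  sum_row : ∀ i, ∑ j, Λ i j = 0

/-- The diffusion matrix `a(i) = σ(i) σ(i)ᵀ`. -/
def diffusion {d k : ℕ} (σ : Fin k → Matrix (Fin d) (Fin d) ℝ) (i : Fin k) :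
    Matrix (Fin d) (Fin d) ℝ :=
  fun l l' => ∑ j, σ i l j * σ i l' j

/-- The partial derivative `∂φ/∂t`. -/
noncomputable def partialT {d k : ℕ} (φ : ℝ → (Fin d → ℝ) → Fin k → ℝ) :
    ℝ → (Fin d → ℝ) → Fin k → ℝ :=
  fun t s i => deriv (fun τ => φ τ s i) t

/-- The partial derivative `∂φ/∂s_l`. -/
noncomputable def partialS {d k : ℕ} (l : Fin d) (φ : ℝ → (Fin d → ℝ) → Fin k → ℝ) :
    ℝ → (Fin d → ℝ) → Fin k → ℝ :=
  fun t s i => deriv (fun x => φ t (Function.update s l x) i) (s l)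

/-- For each `i`, the function `φ(·, ·, i)` is jointly continuous on `I × (0, ∞)^d`. -/
def JointContOn {d k : ℕ} (I : Set ℝ) (φ : ℝ → (Fin d → ℝ) → Fin k → ℝ) : Prop :=
  ∀ i, ContinuousOn (fun p : ℝ × (Fin d → ℝ) => φ p.1 p.2 i) (I ×ˢ orthant d)

/-- `φ` is differentiable in the variable `s_l` on `(0, T) × (0, ∞)^d`. -/
def DiffInS {d k : ℕ} (T : ℝ) (l : Fin d) (φ : ℝ → (Fin d → ℝ) → Fin k → ℝ) : Prop :=
  ∀ t ∈ Set.Ioo 0 T, ∀ s ∈ orthant d, ∀ i,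
    DifferentiableAt ℝ (fun x => φ t (Function.update s l x) i) (s l)

/-- Each `φ(·, ·, i)` is of class `C^{1,2}` on `(0, T) × (0, ∞)^d`: the derivatives `∂φ/∂t`,
`∂φ/∂s_l` and `∂²φ/∂s_l∂s_l'` exist and are continuous there. -/
structure IsC12 {d k : ℕ} (T : ℝ) (φ : ℝ → (Fin d → ℝ) → Fin k → ℝ) : Prop where
  diff_t : ∀ t ∈ Set.Ioo 0 T, ∀ s ∈ orthant d, ∀ i, DifferentiableAt ℝ (fun τ => φ τ s i) t
  cont_t : JointContOn (Set.Ioo 0 T) (partialT φ)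
  diff_s : ∀ l, DiffInS T l φ
  cont_s : ∀ l, JointContOn (Set.Ioo 0 T) (partialS l φ)
  diff_ss : ∀ l l', DiffInS T l (partialS l' φ)
  cont_ss : ∀ l l', JointContOn (Set.Ioo 0 T) (partialS l (partialS l' φ))

/-- The operator `𝕃`. -/
noncomputable def opL {d k : ℕ} (r : Fin k → ℝ) (σ : Fin k → Matrix (Fin d) (Fin d) ℝ)
    (Λ : Matrix (Fin k) (Fin k) ℝ) (φ : ℝ → (Fin d → ℝ) → Fin k → ℝ) :
    ℝ → (Fin d → ℝ) → Fin k → ℝ :=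
  fun t s i =>
    r i * ∑ l, s l * partialS l φ t s i
      + (1 / 2) * ∑ l, ∑ l', diffusion σ i l l' * s l * s l' * partialS l (partialS l' φ) t s i
      - r i * φ t s i
      + ∑ j, Λ i j * φ t s j

/-- The linear-growth class `V`: each `φ(·, ·, i)` is continuous on `(0, T) × (0, ∞)^d`, and
`sup |φ(t, s, i) / (1 + ‖s‖₁)|` over `(0, T) × (0, ∞)^d × Fin k` is finite. -/
def classV (d k : ℕ) (T : ℝ) : Set (ℝ → (Fin d → ℝ) → Fin k → ℝ) :=
  {φ | JointContOn (Set.Ioo 0 T) φ ∧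
    BddAbove {y | ∃ t ∈ Set.Ioo 0 T, ∃ s ∈ orthant d, ∃ i, y = |φ t s i / (1 + ∑ l, |s l|)|}}

/-- `φ` is a classical solution of `∂φ/∂t + 𝕃φ = 0` on `(0, T) × (0, ∞)^d × Fin k` with
`φ(T, s, i) = K(s)`. The values of `φ` outside `(0, T] × (0, ∞)^d × Fin k` are irrelevant. -/
structure IsClassicalSolution {d k : ℕ} (T : ℝ) (r : Fin k → ℝ)
    (σ : Fin k → Matrix (Fin d) (Fin d) ℝ) (Λ : Matrix (Fin k) (Fin k) ℝ)
    (K : (Fin d → ℝ) → ℝ) (φ : ℝ → (Fin d → ℝ) → Fin k → ℝ) : Prop where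
  contDiff : IsC12 T φ
  cont : JointContOn (Set.Ioc 0 T) φ
  pde : ∀ t ∈ Set.Ioo 0 T, ∀ s ∈ orthant d, ∀ i, partialT φ t s i + opL r σ Λ φ t s i = 0
  terminal : ∀ s ∈ orthant d, ∀ i, φ T s i = K s

end RegimeSwitching

/-! Uniqueness rests on a maximum principle on the unbounded orthant. The functions `exp (γ (T - t))
* s ^ q` are eigenfunctions of `∂_t + 𝕃`, because the zero row sums of `Λ` remove the coupling of a
state-independent function. For `γ` above all the eigenvalues, any nonzero nonnegative combination
is a strict supersolution. Adding `ε` times the monomials with exponents `±4` dominates anything of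
size `barrier 2` near the boundary of the orthant and at infinity, which reduces the matter to a
compact set (`HasC12.nonpos_of_strict_subsolution`). Letting `ε → 0` gives `exists_comparison`: an
upper bound by monomials at time `T` propagates backwards up to a constant factor.

Existence is by Fourier analysis in logarithmic coordinates. The payoff is not integrable there, but
its quotient `h` by `barrier 2 = ∏ (s_l ^ 2 + s_l ^ (-2))` is integrable and uniformly continuous.
Multiplying the barrier out, `K` is the sum over sign patterns of `s ^ p * h (log s)` with `p = (±2,
…, ±2)`, and each summand is formally a superposition of the powers `s ^ (p + 2πiξ)` with weight `𝓕
h ξ`. On such a power the equation becomes a linear ODE in `ℂ^k`, solved by a matrix exponential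
(`evol`). Ellipticity gives it Gaussian decay in `ξ` (`exists_evol_bound`), so before time `T` the
integral converges and may be differentiated under the sign (`modeSol_pde`).

The delicate point is time `T`, where the Gaussian factor is lost and `𝓕 h` need not be integrable.
Cutting `𝓕 h` off by the transforms of mollifiers (`exists_fourier_mollifier`) gives solutions
continuous up to `T` whose terminal values approach `K` uniformly relative to `barrier 2`.
Comparison carries this to all times, so the limit is continuous up to `T`. Comparison with `A (1 +
‖s‖₁) + δ * barrier 2` as `δ → 0` gives linear growth (`continuous_and_growth_of_tendsto`). -/

namespace RegimeSwitching

open Set Filter Topology MeasureTheory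
open scoped FourierTransform Convolution

/-! ### Calculus with partial derivatives, and second-order conditions at a maximum. -/

/-- A function whose partial derivatives exist near `x` and are continuous at `x` is
differentiable at `x`. -/
theorem hasFDerivAt_of_partials {d : ℕ} {f : (Fin d → ℝ) → ℝ} {g : Fin d → (Fin d → ℝ) → ℝ}
    {x : Fin d → ℝ}
    (hd : ∀ᶠ y in 𝓝 x, ∀ l, HasDerivAt (fun z => f (Function.update y l z)) (g l y) (y l))
    (hc : ∀ l, ContinuousAt (g l) x) :
    HasFDerivAt f (∑ l, g l x • ContinuousLinearMap.proj (R := ℝ) (φ := fun _ : Fin d => ℝ) l)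
      x := by
  rw [hasFDerivAt_iff_isLittleO, Asymptotics.isLittleO_iff]
  intro c hc0
  -- Passing from `x` to `y` takes `d` coordinate moves, each with error `ε * ‖y - x‖`; the `+ 1`
  -- covers `d = 0`.
  set ε : ℝ := c / (d + 1) with hε
  have hε0 : 0 < ε := by positivity
  have hg : ∀ᶠ y in 𝓝 x, ∀ l, ‖g l y - g l x‖ ≤ ε := by
    rw [eventually_all]
    intro l
    filter_upwards [(hc l).eventually (Metric.closedBall_mem_nhds _ hε0)] with y hy
    simpa [Metric.mem_closedBall, dist_eq_norm] using hy
  obtain ⟨δ, hδ, hball⟩ := Metric.eventually_nhds_iff_ball.1 (hd.and hg)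
  filter_upwards [Metric.ball_mem_nhds x hδ] with y hy
  -- Induction on the set `S` of coordinates already moved from `x` to `y`; each move is a
  -- one-variable mean value inequality for `f` minus its linear part.
  have key : ∀ S : Finset (Fin d),
      ‖f (S.piecewise y x) - f x - ∑ l ∈ S, g l x * (y l - x l)‖ ≤ S.card * (ε * ‖y - x‖) := by
    intro S
    induction S using Finset.induction_on with
    | empty => simp
    | insert l S hl ih =>
      set P := S.piecewise y x with hP
      have hPb : ∀ z, dist z (x l) < δ → Function.update P l z ∈ Metric.ball x δ := by
        intro z hz
        rw [Metric.mem_ball, dist_pi_lt_iff hδ]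
        intro m
        by_cases hm : m = l
        · subst hm; simpa using hz
        · rw [Function.update_of_ne hm]
          by_cases hmS : m ∈ S
          · simp only [hP, Finset.piecewise_eq_of_mem _ _ _ hmS]
            exact (dist_le_pi_dist y x m).trans_lt hy
          · simp [hP, Finset.piecewise_eq_of_notMem _ _ _ hmS, hδ]
      have hPl : P l = x l := by simp [hP, hl]
      have hder : ∀ z ∈ Metric.ball (x l) δ, HasDerivWithinAt
          (fun z => f (Function.update P l z) - g l x * z)
          (g l (Function.update P l z) - g l x) (Metric.ball (x l) δ) z := by
        intro z hz
        have h1 := (hball _ (hPb z hz)).1 l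
        simp only [Function.update_idem, Function.update_self] at h1
        have h2 := h1.sub ((hasDerivAt_id z).const_mul (g l x))
        simpa using! h2.hasDerivWithinAt
      have hyl : y l ∈ Metric.ball (x l) δ := (dist_le_pi_dist y x l).trans_lt hy
      have hmv := Convex.norm_image_sub_le_of_norm_hasDerivWithin_le hder
        (fun z hz => (hball _ (hPb z hz)).2 l) (convex_ball _ _) (Metric.mem_ball_self hδ) hyl
      have hupd : Function.update P l (x l) = P := by rw [← hPl, Function.update_eq_self]
      rw [hupd] at hmv
      rw [Finset.piecewise_insert, Finset.sum_insert hl, Finset.card_insert_of_notMem hl]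
      have hn : ‖y l - x l‖ ≤ ‖y - x‖ := norm_le_pi_norm (y - x) l
      calc _ = ‖(f (Function.update P l (y l)) - g l x * y l - (f P - g l x * x l))
              + (f P - f x - ∑ l ∈ S, g l x * (y l - x l))‖ := by congr 1; ring
        _ ≤ ε * ‖y l - x l‖ + S.card * (ε * ‖y - x‖) := (norm_add_le _ _).trans (add_le_add hmv ih)
        _ ≤ ε * ‖y - x‖ + S.card * (ε * ‖y - x‖) := by gcongr
        _ = _ := by push_cast; ring
  have := key Finset.univ
  simp only [Finset.piecewise_univ, Finset.card_univ, Fintype.card_fin] at this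
  have h2 : (∑ l, g l x • ContinuousLinearMap.proj (R := ℝ) (φ := fun _ : Fin d => ℝ) l) (y - x)
      = ∑ l, g l x * (y l - x l) := by
    simp
  rw [h2]
  refine this.trans ?_
  rw [← mul_assoc]
  gcongr
  rw [hε, ← mul_div_assoc, div_le_iff₀ (by positivity)]
  nlinarith

/-- The derivative along a line of a function with continuous partial derivatives. -/
theorem hasDerivAt_line_of_partials {d : ℕ} {f : (Fin d → ℝ) → ℝ}
    {g : Fin d → (Fin d → ℝ) → ℝ} {x v : Fin d → ℝ} {τ : ℝ}
    (hd : ∀ᶠ y in 𝓝 (x + τ • v), ∀ l,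
      HasDerivAt (fun z => f (Function.update y l z)) (g l y) (y l))
    (hc : ∀ l, ContinuousAt (g l) (x + τ • v)) :
    HasDerivAt (fun τ : ℝ => f (x + τ • v)) (∑ l, g l (x + τ • v) * v l) τ := by
  have h1 := hasFDerivAt_of_partials hd hc
  have h2 : HasDerivAt (fun τ : ℝ => x + τ • v) v τ := by
    simpa using ((hasDerivAt_id τ).smul_const v).const_add x
  have h3 := h1.comp_hasDerivAt τ h2
  simpa using! h3

/-- The second derivative of a function of one variable is nonpositive at a local maximum. -/
theorem second_deriv_nonpos_of_isLocalMax {f f' : ℝ → ℝ} {x a : ℝ}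
    (hf : ∀ᶠ y in 𝓝 x, HasDerivAt f (f' y) y) (hf' : HasDerivAt f' a x) (hx : IsLocalMax f x) :
    a ≤ 0 := by
  by_contra! ha
  have hd : deriv f =ᶠ[𝓝 x] f' := hf.mono fun y hy => hy.deriv
  have hdd : deriv (deriv f) x = a := by rw [hd.deriv_eq, hf'.deriv]
  -- If `a > 0`, then `x` is a local minimum as well as a local maximum. So `f` is locally constant
  -- and its second derivative vanishes, a contradiction.
  have hmin : IsLocalMin f x := isLocalMin_of_deriv_deriv_pos (by rw [hdd]; exact ha)
    hx.deriv_eq_zero hf.self_of_nhds.continuousAt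
  have hconst : f =ᶠ[𝓝 x] fun _ => f x := by
    filter_upwards [hx, hmin] with y h1 h2 using le_antisymm h1 h2
  have h0 : deriv f =ᶠ[𝓝 x] fun _ => 0 := by
    filter_upwards [hconst.eventuallyEq_nhds] with y hy
    rw [hy.deriv_eq]; simp
  rw [h0.deriv_eq] at hdd
  simp at hdd
  linarith

/-- The Hessian quadratic form is nonpositive at a local maximum. -/
theorem hessian_nonpos_of_isLocalMax {d : ℕ} {f : (Fin d → ℝ) → ℝ}
    {g : Fin d → (Fin d → ℝ) → ℝ} {H : Fin d → Fin d → (Fin d → ℝ) → ℝ} {x : Fin d → ℝ}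
    (hd : ∀ᶠ y in 𝓝 x, ∀ l, HasDerivAt (fun z => f (Function.update y l z)) (g l y) (y l))
    (hc : ∀ᶠ y in 𝓝 x, ∀ l, ContinuousAt (g l) y)
    (hdd : ∀ᶠ y in 𝓝 x, ∀ l l', HasDerivAt (fun z => g l' (Function.update y l z)) (H l l' y) (y l))
    (hcc : ∀ l l', ContinuousAt (H l l') x) (hx : IsLocalMax f x) (v : Fin d → ℝ) :
    ∑ l, ∑ l', v l * v l' * H l l' x ≤ 0 := by
  have hx0 : x + (0 : ℝ) • v = x := by simp
  have hline : Tendsto (fun τ : ℝ => x + τ • v) (𝓝 0) (𝓝 x) := by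
    have : Continuous (fun τ : ℝ => x + τ • v) := by fun_prop
    simpa using this.tendsto 0
  have h1 : ∀ᶠ τ : ℝ in 𝓝 0,
      HasDerivAt (fun τ : ℝ => f (x + τ • v)) (∑ l, g l (x + τ • v) * v l) τ := by
    filter_upwards [hline.eventually hd.eventually_nhds, hline.eventually hc] with τ h1 h2
    exact hasDerivAt_line_of_partials h1 h2
  have h2 : HasDerivAt (fun τ : ℝ => ∑ l, g l (x + τ • v) * v l)
      (∑ l', (∑ l, H l l' x * v l) * v l') 0 := by
    refine HasDerivAt.fun_sum fun l' _ => HasDerivAt.mul_const ?_ _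
    have := hasDerivAt_line_of_partials (f := g l') (g := fun l => H l l') (x := x) (v := v)
      (τ := 0) (by rw [hx0]; exact hdd.mono fun y hy l => hy l l')
      (by rw [hx0]; exact fun l => hcc l l')
    simpa only [hx0] using this
  have h3 : IsLocalMax (fun τ : ℝ => f (x + τ • v)) 0 := by
    have : ∀ᶠ τ : ℝ in 𝓝 0, f (x + τ • v) ≤ f x := hline.eventually hx
    simpa [IsLocalMax, IsMaxFilter] using this
  have h4 := second_deriv_nonpos_of_isLocalMax h1 h2 h3
  refine le_trans (le_of_eq ?_) h4
  rw [Finset.sum_comm]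
  refine Finset.sum_congr rfl fun l' _ => ?_
  rw [Finset.sum_mul]
  exact Finset.sum_congr rfl fun l _ => by ring

/-! ### Functions of class `C^{1,2}` on the orthant and the maximum principle. -/

theorem isOpen_orthant (d : ℕ) : IsOpen (orthant d) := by
  have : orthant d = Set.univ.pi fun _ => Ioi 0 := by ext s; simp [orthant]
  rw [this]
  exact isOpen_set_pi finite_univ fun _ _ => isOpen_Ioi

theorem eventually_update_mem_orthant {d : ℕ} {s : Fin d → ℝ} (hs : s ∈ orthant d) (l : Fin d) :
    ∀ᶠ x in 𝓝 (s l), Function.update s l x ∈ orthant d := by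
  have hc : Continuous fun x : ℝ => Function.update s l x := by fun_prop
  refine (hc.tendsto (s l)).eventually ((isOpen_orthant d).mem_nhds ?_)
  rwa [Function.update_eq_self]

/-- Explicit derivatives witnessing that `φ` is of class `C^{1,2}` on `(0, T) × (0, ∞)^d`. -/
structure HasC12 {d k : ℕ} (T : ℝ) (φ φt : ℝ → (Fin d → ℝ) → Fin k → ℝ)
    (φs : Fin d → ℝ → (Fin d → ℝ) → Fin k → ℝ)
    (φss : Fin d → Fin d → ℝ → (Fin d → ℝ) → Fin k → ℝ) : Prop where
  time : ∀ t ∈ Ioo 0 T, ∀ s ∈ orthant d, ∀ i, HasDerivAt (fun τ => φ τ s i) (φt t s i) t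
  space : ∀ l, ∀ t ∈ Ioo 0 T, ∀ s ∈ orthant d, ∀ i,
    HasDerivAt (fun x => φ t (Function.update s l x) i) (φs l t s i) (s l)
  space_space : ∀ l l', ∀ t ∈ Ioo 0 T, ∀ s ∈ orthant d, ∀ i,
    HasDerivAt (fun x => φs l' t (Function.update s l x) i) (φss l l' t s i) (s l)
  cont_time : JointContOn (Ioo 0 T) φt
  cont_space : ∀ l, JointContOn (Ioo 0 T) (φs l)
  cont_space_space : ∀ l m, JointContOn (Ioo 0 T) (φss l m)

/-- The operator `𝕃` expressed through given first and second space derivatives. -/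
noncomputable def jetL {d k : ℕ} (r : Fin k → ℝ) (σ : Fin k → Matrix (Fin d) (Fin d) ℝ)
    (Λ : Matrix (Fin k) (Fin k) ℝ) (φ : ℝ → (Fin d → ℝ) → Fin k → ℝ)
    (φs : Fin d → ℝ → (Fin d → ℝ) → Fin k → ℝ)
    (φss : Fin d → Fin d → ℝ → (Fin d → ℝ) → Fin k → ℝ)
    (t : ℝ) (s : Fin d → ℝ) (i : Fin k) : ℝ :=
  r i * ∑ l, s l * φs l t s i
    + (1 / 2) * ∑ l, ∑ l', diffusion σ i l l' * s l * s l' * φss l l' t s i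
    - r i * φ t s i
    + ∑ j, Λ i j * φ t s j

section HasC12

variable {d k : ℕ} {T : ℝ} {φ φt ψ ψt : ℝ → (Fin d → ℝ) → Fin k → ℝ}
  {φs ψs : Fin d → ℝ → (Fin d → ℝ) → Fin k → ℝ}
  {φss ψss : Fin d → Fin d → ℝ → (Fin d → ℝ) → Fin k → ℝ}

theorem JointContOn.congr {I : Set ℝ} (h : JointContOn I φ)
    (heq : ∀ t ∈ I, ∀ s ∈ orthant d, ∀ i, ψ t s i = φ t s i) : JointContOn I ψ :=
  fun i => (h i).congr fun p hp => heq p.1 hp.1 p.2 hp.2 i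

theorem HasC12.partialT_eq (h : HasC12 T φ φt φs φss) {t : ℝ} (ht : t ∈ Ioo 0 T)
    {s : Fin d → ℝ} (hs : s ∈ orthant d) (i : Fin k) : partialT φ t s i = φt t s i :=
  (h.time t ht s hs i).deriv

theorem HasC12.partialS_eq (h : HasC12 T φ φt φs φss) (l : Fin d) {t : ℝ} (ht : t ∈ Ioo 0 T)
    {s : Fin d → ℝ} (hs : s ∈ orthant d) (i : Fin k) : partialS l φ t s i = φs l t s i :=
  (h.space l t ht s hs i).deriv

/-- The orthant is open, so `partialS l' φ` agrees with the given `φs l'` near the base point. This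
is what allows iterated `deriv`s to be replaced by explicit formulas. -/
theorem HasC12.hasDerivAt_partialS (h : HasC12 T φ φt φs φss) (l l' : Fin d) {t : ℝ}
    (ht : t ∈ Ioo 0 T) {s : Fin d → ℝ} (hs : s ∈ orthant d) (i : Fin k) :
    HasDerivAt (fun x => partialS l' φ t (Function.update s l x) i) (φss l l' t s i) (s l) := by
  refine (h.space_space l l' t ht s hs i).congr_of_eventuallyEq ?_
  filter_upwards [eventually_update_mem_orthant hs l] with x hx
  exact h.partialS_eq l' ht hx i

theorem HasC12.partialS_partialS_eq (h : HasC12 T φ φt φs φss) (l l' : Fin d) {t : ℝ}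
    (ht : t ∈ Ioo 0 T) {s : Fin d → ℝ} (hs : s ∈ orthant d) (i : Fin k) :
    partialS l (partialS l' φ) t s i = φss l l' t s i :=
  (h.hasDerivAt_partialS l l' ht hs i).deriv

theorem HasC12.isC12 (h : HasC12 T φ φt φs φss) : IsC12 T φ where
  diff_t t ht s hs i := (h.time t ht s hs i).differentiableAt
  cont_t := h.cont_time.congr fun _ ht _ hs i => h.partialT_eq ht hs i
  diff_s l t ht s hs i := (h.space l t ht s hs i).differentiableAt
  cont_s l := (h.cont_space l).congr fun _ ht _ hs i => h.partialS_eq l ht hs i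
  diff_ss l l' _ ht _ hs i := (h.hasDerivAt_partialS l l' ht hs i).differentiableAt
  cont_ss l l' := (h.cont_space_space l l').congr fun _ ht _ hs i =>
    h.partialS_partialS_eq l l' ht hs i

theorem IsC12.hasC12 (h : IsC12 T φ) : HasC12 T φ (partialT φ) (fun l => partialS l φ)
    (fun l l' => partialS l (partialS l' φ)) where
  time t ht s hs i := (h.diff_t t ht s hs i).hasDerivAt
  space l t ht s hs i := (h.diff_s l t ht s hs i).hasDerivAt
  space_space l l' t ht s hs i := (h.diff_ss l l' t ht s hs i).hasDerivAt
  cont_time := h.cont_t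
  cont_space := h.cont_s
  cont_space_space := h.cont_ss

theorem HasC12.opL_eq (h : HasC12 T φ φt φs φss) (r : Fin k → ℝ)
    (σ : Fin k → Matrix (Fin d) (Fin d) ℝ) (Λ : Matrix (Fin k) (Fin k) ℝ) {t : ℝ}
    (ht : t ∈ Ioo 0 T) {s : Fin d → ℝ} (hs : s ∈ orthant d) (i : Fin k) :
    opL r σ Λ φ t s i = jetL r σ Λ φ φs φss t s i := by
  simp only [opL, jetL, h.partialS_eq _ ht hs, h.partialS_partialS_eq _ _ ht hs]

theorem HasC12.sub (h : HasC12 T φ φt φs φss) (h' : HasC12 T ψ ψt ψs ψss) :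
    HasC12 T (φ - ψ) (φt - ψt) (φs - ψs) (φss - ψss) where
  time t ht s hs i := (h.time t ht s hs i).sub (h'.time t ht s hs i)
  space l t ht s hs i := (h.space l t ht s hs i).sub (h'.space l t ht s hs i)
  space_space l l' t ht s hs i := (h.space_space l l' t ht s hs i).sub
    (h'.space_space l l' t ht s hs i)
  cont_time i := (h.cont_time i).sub (h'.cont_time i)
  cont_space l i := (h.cont_space l i).sub (h'.cont_space l i)
  cont_space_space l l' i := (h.cont_space_space l l' i).sub (h'.cont_space_space l l' i)

theorem jetL_sub (r : Fin k → ℝ) (σ : Fin k → Matrix (Fin d) (Fin d) ℝ)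
    (Λ : Matrix (Fin k) (Fin k) ℝ) (t : ℝ) (s : Fin d → ℝ) (i : Fin k) :
    jetL r σ Λ (φ - ψ) (φs - ψs) (φss - ψss) t s i
      = jetL r σ Λ φ φs φss t s i - jetL r σ Λ ψ ψs ψss t s i := by
  simp only [jetL, Pi.sub_apply, mul_sub, Finset.sum_sub_distrib]
  ring

theorem HasC12.sum {ι : Type*} [Fintype ι] {φ φt : ι → ℝ → (Fin d → ℝ) → Fin k → ℝ}
    {φs : ι → Fin d → ℝ → (Fin d → ℝ) → Fin k → ℝ}
    {φss : ι → Fin d → Fin d → ℝ → (Fin d → ℝ) → Fin k → ℝ}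
    (h : ∀ a, HasC12 T (φ a) (φt a) (φs a) (φss a)) :
    HasC12 T (fun t s i => ∑ a, φ a t s i) (fun t s i => ∑ a, φt a t s i)
      (fun l t s i => ∑ a, φs a l t s i) (fun l l' t s i => ∑ a, φss a l l' t s i) where
  time t ht s hs i := HasDerivAt.fun_sum fun a _ => (h a).time t ht s hs i
  space l t ht s hs i := HasDerivAt.fun_sum fun a _ => (h a).space l t ht s hs i
  space_space l l' t ht s hs i :=
    HasDerivAt.fun_sum fun a _ => (h a).space_space l l' t ht s hs i
  cont_time i := continuousOn_finsetSum _ fun a _ => (h a).cont_time i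
  cont_space l i := continuousOn_finsetSum _ fun a _ => (h a).cont_space l i
  cont_space_space l l' i := continuousOn_finsetSum _ fun a _ => (h a).cont_space_space l l' i

theorem jetL_sum {ι : Type*} [Fintype ι] (φ : ι → ℝ → (Fin d → ℝ) → Fin k → ℝ)
    (φs : ι → Fin d → ℝ → (Fin d → ℝ) → Fin k → ℝ)
    (φss : ι → Fin d → Fin d → ℝ → (Fin d → ℝ) → Fin k → ℝ)
    (r : Fin k → ℝ) (σ : Fin k → Matrix (Fin d) (Fin d) ℝ)
    (Λ : Matrix (Fin k) (Fin k) ℝ) (t : ℝ) (s : Fin d → ℝ) (i : Fin k) :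
    jetL r σ Λ (fun t s i => ∑ a, φ a t s i) (fun l t s i => ∑ a, φs a l t s i)
      (fun l l' t s i => ∑ a, φss a l l' t s i) t s i
      = ∑ a, jetL r σ Λ (φ a) (φs a) (φss a) t s i := by
  simp only [jetL, Finset.sum_add_distrib, Finset.sum_sub_distrib, Finset.mul_sum]
  congr 2
  · congr 1
    · exact Finset.sum_comm
    · symm
      rw [Finset.sum_comm]
      exact Finset.sum_congr rfl fun l _ => Finset.sum_comm
  · exact Finset.sum_comm

/-- **Maximum principle** for strict subsolutions that are nonpositive at the terminal time and
outside a compact subset of the orthant. -/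
theorem HasC12.nonpos_of_strict_subsolution (h : HasC12 T φ φt φs φss) {r : Fin k → ℝ}
    (hr : ∀ i, 0 ≤ r i) {σ : Fin k → Matrix (Fin d) (Fin d) ℝ} {Λ : Matrix (Fin k) (Fin k) ℝ}
    (hΛ : IsRateMatrix Λ) (hcont : JointContOn (Ioc 0 T) φ)
    (hpos : ∀ t ∈ Ioo 0 T, ∀ s ∈ orthant d, ∀ i, 0 < φt t s i + jetL r σ Λ φ φs φss t s i)
    (hterm : ∀ s ∈ orthant d, ∀ i, φ T s i ≤ 0)
    {C : Set (Fin d → ℝ)} (hC : IsCompact C) (hCo : C ⊆ orthant d)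
    (hout : ∀ t ∈ Ioo 0 T, ∀ s ∈ orthant d, s ∉ C → ∀ i, φ t s i ≤ 0) :
    ∀ t ∈ Ioc 0 T, ∀ s ∈ orthant d, ∀ i, φ t s i ≤ 0 := by
  intro t ht s hs i
  by_contra! hcon
  have htT : t < T := lt_of_le_of_ne ht.2 fun h => by
    subst h; exact absurd (hterm s hs i) (not_le.2 hcon)
  have hsC : s ∈ C := by
    by_contra hsC
    exact absurd (hout t ⟨ht.1, htT⟩ s hs hsC i) (not_le.2 hcon)
  -- The time interval starts at the positive time `t` and includes `T`, so `hcont` applies on the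
  -- whole compact set. The maximum is then taken over the finitely many states too.
  have hD : IsCompact (Icc t T ×ˢ C) := isCompact_Icc.prod hC
  have hmem : (t, s) ∈ Icc t T ×ˢ C := ⟨⟨le_rfl, ht.2⟩, hsC⟩
  have hmax : ∀ j, ∃ p ∈ Icc t T ×ˢ C, ∀ q ∈ Icc t T ×ˢ C, φ q.1 q.2 j ≤ φ p.1 p.2 j := by
    intro j
    obtain ⟨p, hp, hpm⟩ := hD.exists_isMaxOn ⟨_, hmem⟩
      ((hcont j).mono (prod_mono (fun x hx => ⟨ht.1.trans_le hx.1, hx.2⟩) hCo))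
    exact ⟨p, hp, fun q hq => hpm hq⟩
  choose p hp hpm using hmax
  have : Nonempty (Fin k) := ⟨i⟩
  obtain ⟨j, hj⟩ := Finite.exists_max fun j => φ (p j).1 (p j).2 j
  obtain ⟨⟨htp, hpT⟩, hpC⟩ := hp j
  set t₁ := (p j).1
  set s₁ := (p j).2
  set m := φ t₁ s₁ j
  have hm : 0 < m := hcon.trans_le ((hpm i _ hmem).trans (hj i))
  have hs₁ : s₁ ∈ orthant d := hCo hpC
  have ht₁T : t₁ < T := lt_of_le_of_ne hpT fun h => by
    have := hterm s₁ hs₁ j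
    rw [← h] at this
    exact absurd this (not_le.2 hm)
  have ht₁ : t₁ ∈ Ioo 0 T := ⟨ht.1.trans_le htp, ht₁T⟩
  have hle : ∀ τ ∈ Ico t₁ T, ∀ y ∈ orthant d, ∀ a, φ τ y a ≤ m := by
    intro τ hτ y hy a
    by_cases hyC : y ∈ C
    · exact (hpm a (τ, y) ⟨⟨htp.trans hτ.1, hτ.2.le⟩, hyC⟩).trans (hj a)
    · exact (hout τ ⟨ht₁.1.trans_le hτ.1, hτ.2⟩ y hy hyC a).trans hm.le
  -- Only times from `t₁` on are controlled, as `t₁` may be the left endpoint `t`; hence right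
  -- difference quotients.
  have h_t : φt t₁ s₁ j ≤ 0 := by
    have h1 := (hasDerivAt_iff_tendsto_slope.1 (h.time t₁ ht₁ s₁ hs₁ j)).mono_left
      (nhdsWithin_mono t₁ (s := Ioi t₁) fun x hx => ne_of_gt hx)
    refine le_of_tendsto h1 ?_
    filter_upwards [Ioo_mem_nhdsGT ht₁T] with τ hτ
    rw [slope_def_field]
    exact div_nonpos_of_nonpos_of_nonneg
      (sub_nonpos.2 (hle τ ⟨hτ.1.le, hτ.2⟩ s₁ hs₁ j)) (sub_nonneg.2 hτ.1.le)
  have hloc : IsLocalMax (fun y => φ t₁ y j) s₁ := by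
    filter_upwards [(isOpen_orthant d).mem_nhds hs₁] with y hy
    exact hle t₁ ⟨le_rfl, ht₁T⟩ y hy j
  have h_s : ∀ l, φs l t₁ s₁ j = 0 := by
    intro l
    refine IsLocalMax.hasDerivAt_eq_zero (f := fun x => φ t₁ (Function.update s₁ l x) j) ?_
      (h.space l t₁ ht₁ s₁ hs₁ j)
    filter_upwards [eventually_update_mem_orthant hs₁ l] with x hx
    simpa using hle t₁ ⟨le_rfl, ht₁T⟩ _ hx j
  have hslice : ∀ {f : ℝ → (Fin d → ℝ) → Fin k → ℝ}, JointContOn (Ioo 0 T) f →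
      ∀ y ∈ orthant d, ContinuousAt (fun y => f t₁ y j) y := by
    intro f hf y hy
    have h1 := (hf j).continuousAt ((isOpen_Ioo.prod (isOpen_orthant d)).mem_nhds
      (show (t₁, y) ∈ _ from ⟨ht₁, hy⟩))
    exact h1.comp (f := fun y => (t₁, y)) (by fun_prop)
  have hev := (isOpen_orthant d).mem_nhds hs₁
  have h_ss : ∀ v : Fin d → ℝ, ∑ l, ∑ l', v l * v l' * φss l l' t₁ s₁ j ≤ 0 :=
    hessian_nonpos_of_isLocalMax (f := fun y => φ t₁ y j) (g := fun l y => φs l t₁ y j)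
      (H := fun l l' y => φss l l' t₁ y j)
      (by filter_upwards [hev] with y hy l using h.space l t₁ ht₁ y hy j)
      (by filter_upwards [hev] with y hy l using hslice (h.cont_space l) y hy)
      (by filter_upwards [hev] with y hy l l' using h.space_space l l' t₁ ht₁ y hy j)
      (fun l l' => hslice (h.cont_space_space l l') s₁ hs₁) hloc
  -- Since `a = σ σᵀ`, the second-order term is a sum of Hessian quadratic forms, one for each
  -- column `a` of `σ`, in the direction `v l = σ j l a * s₁ l`.
  have hdiff : ∑ l, ∑ l', diffusion σ j l l' * s₁ l * s₁ l' * φss l l' t₁ s₁ j ≤ 0 := by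
    have h1 : ∑ l, ∑ l', diffusion σ j l l' * s₁ l * s₁ l' * φss l l' t₁ s₁ j
        = ∑ a, ∑ l, ∑ l', (σ j l a * s₁ l) * (σ j l' a * s₁ l') * φss l l' t₁ s₁ j := by
      rw [Finset.sum_comm]
      simp_rw [diffusion, Finset.sum_mul]
      rw [Finset.sum_comm]
      rw [Finset.sum_comm (s := Finset.univ) (t := Finset.univ)
        (f := fun a l => ∑ l', (σ j l a * s₁ l) * (σ j l' a * s₁ l') * φss l l' t₁ s₁ j)]
      refine Finset.sum_congr rfl fun l _ => ?_
      rw [Finset.sum_comm]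
      exact Finset.sum_congr rfl fun a _ => Finset.sum_congr rfl fun l' _ => by ring
    rw [h1]
    exact Finset.sum_nonpos fun a _ => h_ss fun l => σ j l a * s₁ l
  have hjump : ∑ a, Λ j a * φ t₁ s₁ a ≤ 0 := by
    -- Zero row sums allow the maximum `m` to be subtracted. The diagonal term then vanishes and the
    -- others have nonnegative rates.
    have h1 : ∑ a, Λ j a * φ t₁ s₁ a = ∑ a, Λ j a * (φ t₁ s₁ a - m) := by
      simp_rw [mul_sub, Finset.sum_sub_distrib, ← Finset.sum_mul, hΛ.sum_row j]
      ring
    rw [h1]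
    refine Finset.sum_nonpos fun a _ => ?_
    by_cases ha : j = a
    · subst ha; simp [m]
    · exact mul_nonpos_of_nonneg_of_nonpos (hΛ.nonneg_of_ne j a ha)
        (sub_nonpos.2 (hle t₁ ⟨le_rfl, ht₁T⟩ s₁ hs₁ a))
  have hfin := hpos t₁ ht₁ s₁ hs₁ j
  have hrm : 0 ≤ r j * φ t₁ s₁ j := mul_nonneg (hr j) hm.le
  simp only [jetL, h_s, mul_zero, Finset.sum_const_zero] at hfin
  linarith

end HasC12

/-! ### Monomials, barriers and the comparison principle. -/

/-- The monomial `∏ l, s_l ^ q_l` on the positive orthant. -/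
noncomputable def rmono {d : ℕ} (q s : Fin d → ℝ) : ℝ := Real.exp (∑ l, q l * Real.log (s l))

theorem rmono_pos {d : ℕ} (q s : Fin d → ℝ) : 0 < rmono q s := Real.exp_pos _

theorem hasDerivAt_rmono {d : ℕ} (q : Fin d → ℝ) {s : Fin d → ℝ} (hs : s ∈ orthant d)
    (l : Fin d) :
    HasDerivAt (fun x => rmono q (Function.update s l x)) (q l / s l * rmono q s) (s l) := by
  have h1 : HasDerivAt (fun x => ∑ m, q m * Real.log (Function.update s l x m))
      (∑ m, if m = l then q l / s l else 0) (s l) := by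
    refine HasDerivAt.fun_sum fun m _ => ?_
    by_cases hm : m = l
    · subst hm
      simpa [div_eq_mul_inv] using (Real.hasDerivAt_log (hs m).ne').const_mul (q m)
    · simpa [hm] using hasDerivAt_const (s l) (q m * Real.log (s m))
  have h2 := h1.exp
  simp only [Function.update_eq_self, Finset.sum_ite_eq', Finset.mem_univ, if_true] at h2
  rw [mul_comm]
  exact h2

theorem continuousOn_rmono {d : ℕ} (q : Fin d → ℝ) : ContinuousOn (rmono q) (orthant d) := by
  unfold rmono
  refine Real.continuous_exp.comp_continuousOn (continuousOn_finsetSum _ fun l _ => ?_)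
  exact continuousOn_const.mul
    ((continuous_apply l).continuousOn.log fun s hs => (hs l).ne')

theorem hasDerivAt_inv_update {d : ℕ} {s : Fin d → ℝ} (hs : s ∈ orthant d) (l l' : Fin d) :
    HasDerivAt (fun x => (Function.update s l x l')⁻¹)
      (if l = l' then -((s l)⁻¹ * (s l')⁻¹) else 0) (s l) := by
  by_cases h : l' = l
  · subst h
    have := hasDerivAt_inv (hs l').ne'
    simp only [Function.update_self, if_true]
    exact this.congr_deriv (by rw [← mul_inv, sq])
  · simpa [h, Ne.symm h] using hasDerivAt_const (s l) (s l')⁻¹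

theorem continuousOn_coord_inv {d : ℕ} (l : Fin d) :
    ContinuousOn (fun s : Fin d → ℝ => (s l)⁻¹) (orthant d) :=
  (continuous_apply l).continuousOn.inv₀ fun _ hs => ne_of_gt (hs l)

/-- The eigenvalue of the Black–Scholes operator in state `i` on the monomial of exponent `q`,
the exponent being real or complex. -/
noncomputable def symbol {d k : ℕ} {𝕜 : Type*} [RCLike 𝕜] (r : Fin k → ℝ)
    (σ : Fin k → Matrix (Fin d) (Fin d) ℝ) (i : Fin k) (q : Fin d → 𝕜) : 𝕜 :=
  (r i : 𝕜) * ∑ l, q l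
    + (1 / 2) * ∑ l, ∑ l', (diffusion σ i l l' : 𝕜) * (q l * q l' - if l = l' then q l else 0)
    - r i

/-- The function `exp (γ (T - t)) * s ^ q` is of class `C^{1,2}`. -/
theorem hasC12_exp_mul_rmono {d k : ℕ} (T γ c : ℝ) (q : Fin d → ℝ) :
    HasC12 (k := k) T (fun t s _ => Real.exp (γ * (T - t)) * (c * rmono q s))
      (fun t s _ => -γ * (Real.exp (γ * (T - t)) * (c * rmono q s)))
      (fun l t s _ => Real.exp (γ * (T - t)) * (c * (q l * (s l)⁻¹ * rmono q s)))
      (fun l l' t s _ => Real.exp (γ * (T - t)) * (c *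
        ((q l * q l' - if l = l' then q l else 0) * ((s l)⁻¹ * (s l')⁻¹) * rmono q s))) where
  time t ht s hs i := by
    have h1 : HasDerivAt (fun τ : ℝ => γ * (T - τ)) (-γ) t := by
      simpa using ((hasDerivAt_id t).const_sub T).const_mul γ
    have h2 := h1.exp.mul_const (c * rmono q s)
    exact h2.congr_deriv (by ring)
  space l t ht s hs i := by
    have := ((hasDerivAt_rmono q hs l).const_mul c).const_mul (Real.exp (γ * (T - t)))
    simpa only [div_eq_mul_inv] using this
  space_space l l' t ht s hs i := by
    have h1 := ((hasDerivAt_inv_update hs l l').const_mul (q l')).fun_mul (hasDerivAt_rmono q hs l)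
    have h2 := (h1.const_mul c).const_mul (Real.exp (γ * (T - t)))
    simp only [Function.update_eq_self] at h2
    refine h2.congr_deriv ?_
    by_cases h : l = l'
    · subst h; simp only [if_true]; ring
    · simp only [h, if_false]; ring
  cont_time i := by
    have := (continuousOn_rmono q).comp continuousOn_snd
      (fun (p : ℝ × (Fin d → ℝ)) (hp : p ∈ Ioo 0 T ×ˢ orthant d) => hp.2)
    refine continuousOn_const.mul (ContinuousOn.mul ?_ (continuousOn_const.mul this))
    fun_prop
  cont_space l i := by
    have h1 := (continuousOn_rmono q).comp continuousOn_snd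
      (fun (p : ℝ × (Fin d → ℝ)) (hp : p ∈ Ioo 0 T ×ˢ orthant d) => hp.2)
    have h2 := (continuousOn_coord_inv l).comp continuousOn_snd
      (fun (p : ℝ × (Fin d → ℝ)) (hp : p ∈ Ioo 0 T ×ˢ orthant d) => hp.2)
    refine ContinuousOn.mul (by fun_prop) (continuousOn_const.mul
      ((continuousOn_const.mul h2).mul h1))
  cont_space_space l l' i := by
    have h1 := (continuousOn_rmono q).comp continuousOn_snd
      (fun (p : ℝ × (Fin d → ℝ)) (hp : p ∈ Ioo 0 T ×ˢ orthant d) => hp.2)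
    have h2 := fun l => (continuousOn_coord_inv l).comp continuousOn_snd
      (fun (p : ℝ × (Fin d → ℝ)) (hp : p ∈ Ioo 0 T ×ˢ orthant d) => hp.2)
    refine ContinuousOn.mul (by fun_prop) (continuousOn_const.mul
      ((continuousOn_const.mul ((h2 l).mul (h2 l'))).mul h1))

/-- The weights `s_l` and `s_l s_l'` in `𝕃` cancel the inverse factors produced by differentiating a
monomial, and the coupling disappears because the function is the same in every state and the rows
of `Λ` sum to zero. -/
theorem jetL_exp_mul_rmono {d k : ℕ} (T γ c : ℝ) (q : Fin d → ℝ) (r : Fin k → ℝ)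
    (σ : Fin k → Matrix (Fin d) (Fin d) ℝ) {Λ : Matrix (Fin k) (Fin k) ℝ} (hΛ : IsRateMatrix Λ)
    (t : ℝ) {s : Fin d → ℝ} (hs : s ∈ orthant d) (i : Fin k) :
    jetL r σ Λ (fun t s _ => Real.exp (γ * (T - t)) * (c * rmono q s))
      (fun l t s _ => Real.exp (γ * (T - t)) * (c * (q l * (s l)⁻¹ * rmono q s)))
      (fun l l' t s _ => Real.exp (γ * (T - t)) * (c *
        ((q l * q l' - if l = l' then q l else 0) * ((s l)⁻¹ * (s l')⁻¹) * rmono q s))) t s i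
      = symbol r σ i q * (Real.exp (γ * (T - t)) * (c * rmono q s)) := by
  simp only [jetL, symbol, ← Finset.sum_mul, hΛ.sum_row, zero_mul, add_zero]
  have h1 : ∑ l, s l * (Real.exp (γ * (T - t)) * (c * (q l * (s l)⁻¹ * rmono q s)))
      = (∑ l, q l) * (Real.exp (γ * (T - t)) * (c * rmono q s)) := by
    rw [Finset.sum_mul]
    refine Finset.sum_congr rfl fun l _ => ?_
    have := (hs l).ne'
    field_simp
  have h2 : ∑ l, ∑ l', diffusion σ i l l' * s l * s l' * (Real.exp (γ * (T - t)) * (c *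
        ((q l * q l' - if l = l' then q l else 0) * ((s l)⁻¹ * (s l')⁻¹) * rmono q s)))
      = (∑ l, ∑ l', diffusion σ i l l' * (q l * q l' - if l = l' then q l else 0))
        * (Real.exp (γ * (T - t)) * (c * rmono q s)) := by
    rw [Finset.sum_mul]
    refine Finset.sum_congr rfl fun l _ => ?_
    rw [Finset.sum_mul]
    refine Finset.sum_congr rfl fun l' _ => ?_
    have h3 := (hs l).ne'
    have h4 := (hs l').ne'
    generalize (q l * q l' - if l = l' then q l else 0) = A
    field_simp
  rw [h1, h2]
  simp only [RCLike.ofReal_real_eq_id, id]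
  ring

/-- The exponents `± m` of the barrier functions, indexed by sign patterns. -/
def signExp {d : ℕ} (m : ℝ) (ε : Fin d → Bool) (l : Fin d) : ℝ := if ε l then m else -m

/-- The barrier `∏ l, (s_l ^ m + s_l ^ (-m))`. -/
noncomputable def barrier {d : ℕ} (m : ℝ) (s : Fin d → ℝ) : ℝ :=
  ∑ ε : Fin d → Bool, rmono (signExp m ε) s

/-- The sum form makes the barrier a combination of eigenfunctions; the product form is the one
suited to estimates, which become factorwise. -/
theorem barrier_eq_prod {d : ℕ} (m : ℝ) (s : Fin d → ℝ) :
    barrier m s = ∏ l, (Real.exp (m * Real.log (s l)) + Real.exp (-m * Real.log (s l))) := by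
  have h1 : ∀ l, Real.exp (m * Real.log (s l)) + Real.exp (-m * Real.log (s l))
      = ∑ b : Bool, Real.exp ((if b then m else -m) * Real.log (s l)) := by
    intro l; simp
  simp_rw [h1]
  rw [Finset.prod_univ_sum, Fintype.piFinset_univ]
  simp_rw [barrier, rmono, signExp, Real.exp_sum]

theorem one_le_exp_add_exp_neg (x : ℝ) : 1 ≤ Real.exp x + Real.exp (-x) := by
  have h1 := Real.add_one_le_exp x
  have h2 := Real.add_one_le_exp (-x)
  linarith

theorem one_le_barrier_factor (m x : ℝ) : 1 ≤ Real.exp (m * x) + Real.exp (-m * x) := by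
  rw [neg_mul]; exact one_le_exp_add_exp_neg _

theorem barrier_pos {d : ℕ} (m : ℝ) (s : Fin d → ℝ) : 0 < barrier m s := by
  rw [barrier_eq_prod]; exact Finset.prod_pos fun l _ => by positivity

theorem barrier_factor_le {d : ℕ} (m : ℝ) (s : Fin d → ℝ) (l : Fin d) :
    Real.exp (m * Real.log (s l)) + Real.exp (-m * Real.log (s l)) ≤ barrier m s := by
  rw [barrier_eq_prod, ← Finset.mul_prod_erase _ _ (Finset.mem_univ l)]
  refine le_mul_of_one_le_right (by positivity) ?_
  refine Finset.prod_induction _ (fun x : ℝ => 1 ≤ x) (fun a b ha hb => ?_) le_rfl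
    fun l _ => one_le_barrier_factor _ _
  nlinarith

/-- Factorwise this is `(a + b) ^ 2 ≤ 2 (a ^ 2 + b ^ 2)`. It shows that `barrier 4` outgrows every
multiple of `barrier 2` where the latter is large. -/
theorem sq_barrier_le {d : ℕ} (m : ℝ) (s : Fin d → ℝ) :
    barrier m s ^ 2 ≤ 2 ^ d * barrier (2 * m) s := by
  rw [barrier_eq_prod, barrier_eq_prod, ← Finset.prod_pow]
  have : (2 : ℝ) ^ d = ∏ _l : Fin d, 2 := by simp
  rw [this, ← Finset.prod_mul_distrib]
  refine Finset.prod_le_prod (fun l _ => by positivity) fun l _ => ?_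
  have h1 : Real.exp (2 * m * Real.log (s l)) = Real.exp (m * Real.log (s l)) ^ 2 := by
    rw [← Real.exp_nat_mul]; congr 1; push_cast; ring
  have h2 : Real.exp (-(2 * m) * Real.log (s l)) = Real.exp (-m * Real.log (s l)) ^ 2 := by
    rw [← Real.exp_nat_mul]; congr 1; push_cast; ring
  rw [h1, h2]
  nlinarith [sq_nonneg (Real.exp (m * Real.log (s l)) - Real.exp (-m * Real.log (s l)))]

theorem continuousOn_barrier {d : ℕ} (m : ℝ) : ContinuousOn (barrier m) (orthant d) :=
  continuousOn_finsetSum _ fun _ _ => continuousOn_rmono _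

/-- The sublevel sets of the barrier are contained in compact boxes. -/
theorem exists_compact_of_barrier_le {d : ℕ} {m : ℝ} (hm : 0 < m) (R : ℝ) :
    ∃ C : Set (Fin d → ℝ), IsCompact C ∧ C ⊆ orthant d ∧
      ∀ s ∈ orthant d, barrier m s ≤ R → s ∈ C := by
  refine ⟨Icc (fun _ => Real.exp (-(Real.log R / m))) (fun _ => Real.exp (Real.log R / m)),
    isCompact_Icc, fun s hs l => (Real.exp_pos _).trans_le (hs.1 l), fun s hs h => ?_⟩
  have hR : 0 < R := (barrier_pos m s).trans_le h
  have key : ∀ l, -(Real.log R / m) ≤ Real.log (s l) ∧ Real.log (s l) ≤ Real.log R / m := by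
    intro l
    have h1 := (barrier_factor_le m s l).trans h
    have h2 : Real.exp (m * Real.log (s l)) ≤ R := by
      linarith [Real.exp_pos (-m * Real.log (s l))]
    have h3 : Real.exp (-m * Real.log (s l)) ≤ R := by
      linarith [Real.exp_pos (m * Real.log (s l))]
    rw [← Real.le_log_iff_exp_le hR] at h2 h3
    constructor
    · rw [neg_le, le_div_iff₀ hm]; linarith
    · rw [le_div_iff₀ hm]; linarith
  constructor
  · intro l
    rw [← Real.exp_log (hs l)]
    exact Real.exp_le_exp.2 (key l).1
  · intro l
    rw [← Real.exp_log (hs l)]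
    exact Real.exp_le_exp.2 (key l).2

/-- **Comparison principle.** A solution of the equation growing at most like `barrier 2` that
lies below a positive combination of monomials at the terminal time stays below the same
combination multiplied by `exp (γ (T - t))`, with `γ` depending only on the exponents. -/
theorem exists_comparison {d k : ℕ} (T : ℝ) {r : Fin k → ℝ} (hr : ∀ i, 0 ≤ r i)
    (σ : Fin k → Matrix (Fin d) (Fin d) ℝ) {Λ : Matrix (Fin k) (Fin k) ℝ} (hΛ : IsRateMatrix Λ)
    {ι : Type*} [Fintype ι] (q : ι → Fin d → ℝ) :
    ∃ γ : ℝ, 0 ≤ γ ∧ ∀ (c : ι → ℝ) (_ : ∀ a, 0 ≤ c a) (u : ℝ → (Fin d → ℝ) → Fin k → ℝ)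
      (_ : IsC12 T u) (_ : JointContOn (Ioc 0 T) u)
      (_ : ∀ t ∈ Ioo 0 T, ∀ s ∈ orthant d, ∀ i, partialT u t s i + opL r σ Λ u t s i = 0)
      (A : ℝ) (_ : ∀ t ∈ Ioo 0 T, ∀ s ∈ orthant d, ∀ i, u t s i ≤ A * barrier 2 s)
      (_ : ∀ s ∈ orthant d, ∀ i, u T s i ≤ ∑ a, c a * rmono (q a) s),
      ∀ t ∈ Ioc 0 T, ∀ s ∈ orthant d, ∀ i,
        u t s i ≤ Real.exp (γ * (T - t)) * ∑ a, c a * rmono (q a) s := by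
  -- The given exponents are enlarged by those of `barrier 4`, which provides the small correction
  -- that wins outside a compact set.
  set Q : ι ⊕ (Fin d → Bool) → Fin d → ℝ := Sum.elim q (signExp 4) with hQ
  obtain ⟨γ₀, hγ₀⟩ := (Set.finite_range fun p : Fin k × (ι ⊕ (Fin d → Bool)) =>
    symbol r σ p.1 (Q p.2)).bddAbove
  set γ := max γ₀ 0 + 1 with hγdef
  have hγ0 : 0 ≤ γ := by positivity
  have hγ : ∀ i b, symbol r σ i (Q b) < γ := by
    intro i b
    have : symbol r σ i (Q b) ≤ γ₀ := hγ₀ ⟨(i, b), rfl⟩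
    have := le_max_left γ₀ 0
    linarith
  refine ⟨γ, hγ0, fun c hc u hu hcont hpde A hA hterm => ?_⟩
  have main : ∀ ε > 0, ∀ t ∈ Ioc 0 T, ∀ s ∈ orthant d, ∀ i,
      u t s i ≤ Real.exp (γ * (T - t)) * ((∑ a, c a * rmono (q a) s) + ε * barrier 4 s) := by
    intro ε hε
    set cc : ι ⊕ (Fin d → Bool) → ℝ := Sum.elim c (fun _ => ε) with hcc
    have hcc0 : ∀ b, 0 ≤ cc b := by
      rintro (a | b)
      · exact hc a
      · exact hε.le
    have hB := HasC12.sum fun b => hasC12_exp_mul_rmono (k := k) T γ (cc b) (Q b)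
    have hsum : ∀ t s, ∑ b, Real.exp (γ * (T - t)) * (cc b * rmono (Q b) s)
        = Real.exp (γ * (T - t)) * ((∑ a, c a * rmono (q a) s) + ε * barrier 4 s) := by
      intro t s
      rw [← Finset.mul_sum, Fintype.sum_sum_type, barrier, Finset.mul_sum]
      rfl
    have hv := hu.hasC12.sub hB
    have hbpos : ∀ s, 0 ≤ ∑ a, c a * rmono (q a) s := fun s =>
      Finset.sum_nonneg fun a _ => mul_nonneg (hc a) (rmono_pos _ _).le
    -- Once `barrier 2 > 2 ^ d * |A| / ε`, the inequality `sq_barrier_le` gives `|A| * barrier 2 ≤ ε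
    -- * barrier 4`.
    obtain ⟨C, hC, hCo, hCin⟩ := exists_compact_of_barrier_le (d := d) (m := 2) two_pos
      (2 ^ d * |A| / ε)
    have hres := hv.nonpos_of_strict_subsolution hr (σ := σ) hΛ ?_ ?_ ?_ hC hCo ?_
    · intro t ht s hs i
      have := hres t ht s hs i
      simp only [Pi.sub_apply, hsum] at this
      linarith
    · intro i
      refine (hcont i).sub ?_
      simp only [hsum]
      have h1 : ∀ {f : (Fin d → ℝ) → ℝ}, ContinuousOn f (orthant d) →
          ContinuousOn (fun p : ℝ × (Fin d → ℝ) => f p.2) (Ioc 0 T ×ˢ orthant d) :=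
        fun hf => hf.comp continuousOn_snd fun p hp => hp.2
      refine ContinuousOn.mul (by fun_prop) (h1 (f := fun s =>
        (∑ a, c a * rmono (q a) s) + ε * barrier 4 s) ?_)
      exact (continuousOn_finsetSum _ fun a _ =>
        continuousOn_const.mul (continuousOn_rmono _)).add
        (continuousOn_const.mul (continuousOn_barrier 4))
    · intro t ht s hs i
      rw [jetL_sub, jetL_sum]
      simp only [Pi.sub_apply]
      simp only [jetL_exp_mul_rmono T γ _ _ r σ hΛ t hs i]
      have h1 := hpde t ht s hs i
      rw [hu.hasC12.opL_eq r σ Λ ht hs i] at h1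
      have h2 : ∑ b, (-γ * (Real.exp (γ * (T - t)) * (cc b * rmono (Q b) s)))
          + ∑ b, symbol r σ i (Q b) * (Real.exp (γ * (T - t)) * (cc b * rmono (Q b) s)) < 0 := by
        rw [← Finset.sum_add_distrib]
        have hle : ∀ b, -γ * (Real.exp (γ * (T - t)) * (cc b * rmono (Q b) s))
            + symbol r σ i (Q b) * (Real.exp (γ * (T - t)) * (cc b * rmono (Q b) s)) ≤ 0 := by
          intro b
          have hp : 0 ≤ Real.exp (γ * (T - t)) * (cc b * rmono (Q b) s) :=
            mul_nonneg (Real.exp_pos _).le (mul_nonneg (hcc0 b) (rmono_pos _ _).le)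
          nlinarith [hγ i b]
        -- All the `c a` may vanish, so strictness is taken from one of the `ε`-terms.
        refine Finset.sum_neg' (fun b _ => hle b) ⟨Sum.inr fun _ => true, Finset.mem_univ _, ?_⟩
        have hp : 0 < Real.exp (γ * (T - t)) * (ε * rmono (signExp 4 fun _ => true) s) :=
          mul_pos (Real.exp_pos _) (mul_pos hε (rmono_pos _ _))
        have := hγ i (Sum.inr fun _ => true)
        simp only [hcc, hQ, Sum.elim_inr] at this ⊢
        nlinarith
      linarith
    · intro s hs i
      simp only [Pi.sub_apply, hsum]
      have := hterm s hs i
      have := mul_pos hε (barrier_pos 4 s)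
      simp only [sub_self, mul_zero, Real.exp_zero, one_mul]
      linarith
    · intro t ht s hs hsC i
      simp only [Pi.sub_apply, hsum]
      have h1 : 2 ^ d * |A| / ε < barrier 2 s := by
        by_contra! h
        exact hsC (hCin s hs h)
      have h2 := sq_barrier_le 2 s
      norm_num at h2
      have hb := barrier_pos 2 s
      rw [div_lt_iff₀ hε] at h1
      have h3 : |A| * barrier 2 s ≤ ε * barrier 4 s := by
        have h4 : (2 : ℝ) ^ d * (|A| * barrier 2 s) ≤ 2 ^ d * (ε * barrier 4 s) := by
          calc (2 : ℝ) ^ d * (|A| * barrier 2 s) = (2 ^ d * |A|) * barrier 2 s := by ring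
            _ ≤ (barrier 2 s * ε) * barrier 2 s := by gcongr
            _ = ε * barrier 2 s ^ 2 := by ring
            _ ≤ ε * (2 ^ d * barrier 4 s) := by gcongr
            _ = _ := by ring
        exact le_of_mul_le_mul_left h4 (by positivity)
      have h5 : A * barrier 2 s ≤ |A| * barrier 2 s := by gcongr; exact le_abs_self A
      have h6 : (∑ a, c a * rmono (q a) s) + ε * barrier 4 s ≤
          Real.exp (γ * (T - t)) * ((∑ a, c a * rmono (q a) s) + ε * barrier 4 s) := by
        refine le_mul_of_one_le_left ?_ ?_
        · have := hbpos s
          have := mul_pos hε (barrier_pos 4 s)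
          linarith
        · exact Real.one_le_exp (mul_nonneg hγ0 (sub_nonneg.2 ht.2.le))
      have := hA t ht s hs i
      have := hbpos s
      linarith
  intro t ht s hs i
  have hlim : Tendsto (fun ε : ℝ => Real.exp (γ * (T - t)) *
      ((∑ a, c a * rmono (q a) s) + ε * barrier 4 s)) (𝓝[>] 0)
      (𝓝 (Real.exp (γ * (T - t)) * ∑ a, c a * rmono (q a) s)) := by
    have hcn : Continuous (fun ε : ℝ => Real.exp (γ * (T - t)) *
      ((∑ a, c a * rmono (q a) s) + ε * barrier 4 s)) := by fun_prop
    have := hcn.tendsto 0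
    simp only [zero_mul, add_zero] at this
    exact this.mono_left nhdsWithin_le_nhds
  exact ge_of_tendsto hlim (by
    filter_upwards [self_mem_nhdsWithin] with ε hε using main ε hε t ht s hs i)

/-! ### The evolution in Fourier space and its Gaussian decay. -/

/-- The complex exponent `p + 2πiξ`. -/
noncomputable def cexponent {d : ℕ} (p : Fin d → ℝ) (ξ : EuclideanSpace ℝ (Fin d)) (l : Fin d) :
    ℂ := p l + 2 * Real.pi * ξ l * Complex.I

@[fun_prop]
theorem continuous_cexponent {d : ℕ} (p : Fin d → ℝ) (l : Fin d) :
    Continuous fun ξ => cexponent p ξ l := by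
  unfold cexponent; fun_prop

theorem sum_diffusion_mul {d k : ℕ} (σ : Fin k → Matrix (Fin d) (Fin d) ℝ) (i : Fin k)
    (x : Fin d → ℝ) :
    ∑ l, ∑ l', diffusion σ i l l' * (x l * x l') = ∑ j, (∑ l, σ i l j * x l) ^ 2 := by
  simp_rw [diffusion, sq, Finset.sum_mul_sum, Finset.sum_mul]
  rw [Finset.sum_comm (s := Finset.univ) (t := Finset.univ) (f := fun j l =>
    ∑ l', σ i l j * x l * (σ i l' j * x l'))]
  refine Finset.sum_congr rfl fun l _ => ?_
  rw [Finset.sum_comm]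
  exact Finset.sum_congr rfl fun j _ => Finset.sum_congr rfl fun l' _ => by ring

/-- Uniform ellipticity of the diffusion matrices. -/
theorem exists_ellipticity {d k : ℕ} {σ : Fin k → Matrix (Fin d) (Fin d) ℝ}
    (hσ : ∀ i, IsUnit (σ i)) :
    ∃ c > 0, ∀ i, ∀ ξ : EuclideanSpace ℝ (Fin d),
      c * ‖ξ‖ ^ 2 ≤ ∑ l, ∑ l', diffusion σ i l l' * (ξ l * ξ l') := by
  -- `N` dominates the squared Frobenius norm of every `(σ i)⁻¹`. Recovering `ξ` from `η = σᵀ ξ` by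
  -- Cauchy–Schwarz gives `‖ξ‖ ^ 2 ≤ N * ‖η‖ ^ 2`.
  set N : ℝ := 1 + ∑ i, ∑ m, ∑ j, ((σ i)⁻¹ j m) ^ 2 with hN
  have hS : ∀ i, 0 ≤ ∑ m, ∑ j, ((σ i)⁻¹ j m) ^ 2 := fun i => by positivity
  have hN0 : 0 < N := by
    have := Finset.sum_nonneg fun i (_ : i ∈ Finset.univ) => hS i
    linarith
  refine ⟨N⁻¹, inv_pos.2 hN0, fun i ξ => ?_⟩
  rw [sum_diffusion_mul, inv_mul_le_iff₀ hN0, EuclideanSpace.real_norm_sq_eq]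
  set η : Fin d → ℝ := fun j => ∑ l, σ i l j * ξ l
  have hinv : σ i * (σ i)⁻¹ = 1 :=
    Matrix.mul_nonsing_inv _ ((Matrix.isUnit_iff_isUnit_det _).1 (hσ i))
  have hξ : ∀ m, ξ m = ∑ j, η j * (σ i)⁻¹ j m := by
    intro m
    simp only [η, Finset.sum_mul]
    rw [Finset.sum_comm]
    have h1 : ∀ l, ∑ j, σ i l j * ξ l * (σ i)⁻¹ j m = (if l = m then 1 else 0) * ξ l := by
      intro l
      have := congrFun (congrFun hinv l) m
      rw [Matrix.mul_apply, Matrix.one_apply] at this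
      rw [← this, Finset.sum_mul]
      exact Finset.sum_congr rfl fun j _ => by ring
    simp [h1]
  have h2 : ∀ m, ξ m ^ 2 ≤ (∑ j, η j ^ 2) * ∑ j, ((σ i)⁻¹ j m) ^ 2 := by
    intro m
    rw [hξ m]
    exact Finset.sum_mul_sq_le_sq_mul_sq _ _ _
  calc ∑ m, ξ m ^ 2 ≤ ∑ m, (∑ j, η j ^ 2) * ∑ j, ((σ i)⁻¹ j m) ^ 2 :=
        Finset.sum_le_sum fun m _ => h2 m
    _ = (∑ m, ∑ j, ((σ i)⁻¹ j m) ^ 2) * ∑ j, η j ^ 2 := by rw [← Finset.mul_sum, mul_comm]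
    _ ≤ N * ∑ j, η j ^ 2 := by
        gcongr
        have := Finset.single_le_sum (fun i _ => hS i) (Finset.mem_univ i)
        linarith

/-- The imaginary shift `2πiξ` affects the real part only through the quadratic terms, where it
contributes minus the elliptic form: the source of the Gaussian decay. -/
theorem symbol_re {d k : ℕ} (r : Fin k → ℝ) (σ : Fin k → Matrix (Fin d) (Fin d) ℝ) (i : Fin k)
    (p : Fin d → ℝ) (ξ : EuclideanSpace ℝ (Fin d)) :
    (symbol r σ i (cexponent p ξ)).re = symbol r σ i p
      - 2 * Real.pi ^ 2 * ∑ l, ∑ l', diffusion σ i l l' * (ξ l * ξ l') := by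
  have hre : ∀ l, (cexponent p ξ l).re = p l := fun l => by simp [cexponent]
  have him : ∀ l, (cexponent p ξ l).im = 2 * Real.pi * ξ l := fun l => by simp [cexponent]
  have h1 : ∀ l l', (if l = l' then cexponent p ξ l else 0).re = if l = l' then p l else 0 := by
    intro l l'; split_ifs <;> simp [hre]
  have hhalf : (1 / 2 : ℂ) = ((1 / 2 : ℝ) : ℂ) := by push_cast; rfl
  have hcoe : ∀ x : ℝ, (RCLike.ofReal x : ℂ) = Complex.ofReal x := fun _ => rfl
  simp only [symbol, hcoe, hhalf, Complex.sub_re, Complex.add_re, Complex.re_ofReal_mul,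
    Complex.re_sum, Complex.ofReal_re, RCLike.ofReal_real_eq_id, id, h1]
  simp only [Complex.mul_re, hre, him]
  have h2 : ∑ l, ∑ l', diffusion σ i l l' *
      (p l * p l' - 2 * Real.pi * ξ l * (2 * Real.pi * ξ l') - if l = l' then p l else 0)
      = ∑ l, ∑ l', diffusion σ i l l' * (p l * p l' - if l = l' then p l else 0)
        - 4 * Real.pi ^ 2 * ∑ l, ∑ l', diffusion σ i l l' * (ξ l * ξ l') := by
    simp only [Finset.mul_sum, ← Finset.sum_sub_distrib]
    exact Finset.sum_congr rfl fun l _ => Finset.sum_congr rfl fun l' _ => by ring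
  rw [h2]
  ring

/-- The matrix symbol of the coupled system at the exponent `p + 2πiξ`. -/
noncomputable def matSymbol {d k : ℕ} (r : Fin k → ℝ) (σ : Fin k → Matrix (Fin d) (Fin d) ℝ)
    (Λ : Matrix (Fin k) (Fin k) ℝ) (p : Fin d → ℝ) (ξ : EuclideanSpace ℝ (Fin d)) :
    Matrix (Fin k) (Fin k) ℂ :=
  Matrix.diagonal (fun i => symbol r σ i (cexponent p ξ)) + Λ.map Complex.ofReal

/-- The evolution in Fourier space, started from the constant vector `1`. -/
noncomputable def evol {d k : ℕ} (r : Fin k → ℝ) (σ : Fin k → Matrix (Fin d) (Fin d) ℝ)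
    (Λ : Matrix (Fin k) (Fin k) ℝ) (p : Fin d → ℝ) (τ : ℝ) (ξ : EuclideanSpace ℝ (Fin d)) :
    Fin k → ℂ :=
  (NormedSpace.exp (τ • matSymbol r σ Λ p ξ)).mulVec 1

section evol

variable {d k : ℕ} (r : Fin k → ℝ) (σ : Fin k → Matrix (Fin d) (Fin d) ℝ)
    (Λ : Matrix (Fin k) (Fin k) ℝ) (p : Fin d → ℝ)

@[fun_prop]
theorem continuous_symbol (i : Fin k) : Continuous fun ξ => symbol r σ i (cexponent p ξ) := by
  unfold symbol
  have : ∀ l l' : Fin d, Continuous fun ξ => if l = l' then cexponent p ξ l else 0 := by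
    intro l l'; split_ifs <;> fun_prop
  fun_prop

@[fun_prop]
theorem continuous_matSymbol : Continuous (matSymbol r σ Λ p) := by
  unfold matSymbol
  have : Continuous fun ξ i => symbol r σ i (cexponent p ξ) := by fun_prop
  exact this.matrix_diagonal.add continuous_const

open scoped Matrix.Norms.Operator in
theorem continuous_evol (i : Fin k) : Continuous fun q : ℝ × EuclideanSpace ℝ (Fin d) =>
    evol r σ Λ p q.1 q.2 i := by
  unfold evol
  have h0 : Continuous fun q : ℝ × EuclideanSpace ℝ (Fin d) => q.1 • matSymbol r σ Λ p q.2 :=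
    continuous_fst.smul ((continuous_matSymbol r σ Λ p).comp continuous_snd)
  have h1 : Continuous fun q : ℝ × EuclideanSpace ℝ (Fin d) =>
      NormedSpace.exp (q.1 • matSymbol r σ Λ p q.2) :=
    (NormedSpace.exp_continuous (𝔸 := Matrix (Fin k) (Fin k) ℂ)).comp h0
  have h2 := h1.matrix_mulVec (continuous_const (y := (1 : Fin k → ℂ)))
  exact (continuous_apply i).comp h2

open scoped Matrix.Norms.Operator in
theorem hasDerivAt_evol (τ : ℝ) (ξ : EuclideanSpace ℝ (Fin d)) (i : Fin k) :
    HasDerivAt (fun τ => evol r σ Λ p τ ξ i)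
      (symbol r σ i (cexponent p ξ) * evol r σ Λ p τ ξ i + ∑ j, (Λ i j : ℂ) * evol r σ Λ p τ ξ j)
      τ := by
  have h1 := hasDerivAt_exp_smul_const' (matSymbol r σ Λ p ξ) τ
  set L : Matrix (Fin k) (Fin k) ℂ →ₗ[ℝ] ℂ :=
    { toFun := fun A => A.mulVec 1 i
      map_add' := fun A B => by simp [Matrix.add_mulVec]
      map_smul' := fun c A => by simp [Matrix.smul_mulVec] } with hL
  have h2 := (LinearMap.toContinuousLinearMap L).hasFDerivAt.comp_hasDerivAt τ h1
  refine (h2 : HasDerivAt (fun τ => evol r σ Λ p τ ξ i) _ τ).congr_deriv ?_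
  change (matSymbol r σ Λ p ξ * NormedSpace.exp (τ • matSymbol r σ Λ p ξ)).mulVec 1 i = _
  rw [← Matrix.mulVec_mulVec]
  change (matSymbol r σ Λ p ξ).mulVec (evol r σ Λ p τ ξ) i = _
  rw [matSymbol, Matrix.add_mulVec, Pi.add_apply, Matrix.mulVec_diagonal]
  rfl

theorem evol_zero (ξ : EuclideanSpace ℝ (Fin d)) (i : Fin k) : evol r σ Λ p 0 ξ i = 1 := by
  simp [evol]

/-- Gaussian decay of the evolution in Fourier space. -/
theorem exists_evol_bound (hσ : ∀ i, IsUnit (σ i)) :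
    ∃ c > 0, ∃ b ≥ 0, ∀ τ ≥ 0, ∀ ξ i,
      ‖evol r σ Λ p τ ξ i‖ ≤ (k + 1) * Real.exp (τ * (b - c * ‖ξ‖ ^ 2)) := by
  obtain ⟨c, hc, hell⟩ := exists_ellipticity hσ
  obtain ⟨b₀, hb₀⟩ := (Set.finite_range fun i => symbol r σ i p).bddAbove
  set lam : ℝ := ∑ i, ∑ j, |Λ i j| with hlam
  have hlam0 : 0 ≤ lam := by positivity
  refine ⟨2 * Real.pi ^ 2 * c, by positivity, max b₀ 0 + lam, by positivity, fun τ hτ ξ i => ?_⟩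
  set b := max b₀ 0 + lam
  set β := b - 2 * Real.pi ^ 2 * c * ‖ξ‖ ^ 2 with hβ
  -- Energy estimate: the diagonal part contributes at most `2 (β - lam) N` to `N'` and the coupling
  -- at most `2 lam N`, so `N' ≤ 2 β N`.
  set N : ℝ → ℝ := fun τ => ∑ i, ‖evol r σ Λ p τ ξ i‖ ^ 2 with hN
  have hre : ∀ i, (symbol r σ i (cexponent p ξ)).re ≤ β - lam := by
    intro i
    rw [symbol_re]
    have h1 : symbol r σ i p ≤ b₀ := hb₀ ⟨i, rfl⟩
    have h2 := le_max_left b₀ 0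
    have h3 := mul_le_mul_of_nonneg_left (hell i ξ) (by positivity : 0 ≤ 2 * Real.pi ^ 2)
    simp only [hβ, b]
    nlinarith
  have hNd : ∀ τ, HasDerivAt N (∑ i, 2 * inner ℝ (evol r σ Λ p τ ξ i)
      (symbol r σ i (cexponent p ξ) * evol r σ Λ p τ ξ i
        + ∑ j, (Λ i j : ℂ) * evol r σ Λ p τ ξ j)) τ := fun τ =>
    HasDerivAt.fun_sum fun i _ => (hasDerivAt_evol r σ Λ p τ ξ i).norm_sq
  have hNd' : ∀ τ, ∑ i, 2 * inner ℝ (evol r σ Λ p τ ξ i)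
      (symbol r σ i (cexponent p ξ) * evol r σ Λ p τ ξ i
        + ∑ j, (Λ i j : ℂ) * evol r σ Λ p τ ξ j) ≤ 2 * β * N τ := by
    intro τ
    set y := evol r σ Λ p τ ξ
    have hle : ∀ i, ‖y i‖ ^ 2 ≤ N τ := fun i =>
      Finset.single_le_sum (f := fun i => ‖y i‖ ^ 2) (fun i _ => by positivity) (Finset.mem_univ i)
    have hN0 : 0 ≤ N τ := Finset.sum_nonneg fun i _ => by positivity
    have h1 : ∀ i, inner ℝ (y i) (symbol r σ i (cexponent p ξ) * y i) ≤ (β - lam) * ‖y i‖ ^ 2 := by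
      intro i
      have : inner ℝ (y i) (symbol r σ i (cexponent p ξ) * y i)
          = (symbol r σ i (cexponent p ξ)).re * ‖y i‖ ^ 2 := by
        rw [Complex.inner, ← Complex.normSq_eq_norm_sq]
        simp [Complex.normSq_apply]
        ring
      rw [this]
      gcongr
      exact hre i
    have h2 : ∀ i j, inner ℝ (y i) ((Λ i j : ℂ) * y j) ≤ |Λ i j| * N τ := by
      intro i j
      refine (real_inner_le_norm _ _).trans ?_
      rw [norm_mul, Complex.norm_real, Real.norm_eq_abs]
      have : ‖y i‖ * ‖y j‖ ≤ N τ := by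
        nlinarith [hle i, hle j, sq_nonneg (‖y i‖ - ‖y j‖)]
      nlinarith [mul_le_mul_of_nonneg_left this (abs_nonneg (Λ i j))]
    calc _ ≤ ∑ i, 2 * ((β - lam) * ‖y i‖ ^ 2 + ∑ j, |Λ i j| * N τ) := by
          refine Finset.sum_le_sum fun i _ => ?_
          rw [inner_add_right, inner_sum]
          gcongr
          · exact h1 i
          · exact h2 _ _
      _ = 2 * ((β - lam) * N τ + lam * N τ) := by
          rw [← Finset.mul_sum, Finset.sum_add_distrib, ← Finset.mul_sum]
          simp_rw [← Finset.sum_mul]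
          rfl
      _ = _ := by ring
  -- Grönwall: `G` is antitone and `G 0 = k`. The constant `k + 1` in the claim serves as an upper
  -- bound for `√k`.
  set G : ℝ → ℝ := fun τ => Real.exp (-(2 * β * τ)) * N τ
  have hG : ∀ τ, HasDerivAt G (Real.exp (-(2 * β * τ)) * -(2 * β) * N τ
      + Real.exp (-(2 * β * τ)) * _) τ := fun τ => by
    have h1 : HasDerivAt (fun τ : ℝ => -(2 * β * τ)) (-(2 * β)) τ := by
      simpa using! ((hasDerivAt_id τ).const_mul (2 * β)).neg
    exact h1.exp.mul (hNd τ)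
  have hanti : Antitone G := antitone_of_deriv_nonpos (fun τ => (hG τ).differentiableAt)
    fun τ => by
      rw [(hG τ).deriv]
      have := mul_le_mul_of_nonneg_left (hNd' τ) (Real.exp_pos (-(2 * β * τ))).le
      linarith
  have hfin := hanti hτ
  simp only [G, mul_zero, neg_zero, Real.exp_zero, one_mul, hN, evol_zero] at hfin
  simp only [norm_one, one_pow, Finset.sum_const, Finset.card_univ, Fintype.card_fin,
    nsmul_eq_mul, mul_one] at hfin
  have h3 : ‖evol r σ Λ p τ ξ i‖ ^ 2 ≤ ((k + 1) * Real.exp (τ * β)) ^ 2 := by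
    have h4 : ‖evol r σ Λ p τ ξ i‖ ^ 2 ≤ ∑ i, ‖evol r σ Λ p τ ξ i‖ ^ 2 :=
      Finset.single_le_sum (f := fun i => ‖evol r σ Λ p τ ξ i‖ ^ 2)
        (fun i _ => by positivity) (Finset.mem_univ i)
    have h5 : Real.exp (-(2 * β * τ)) = (Real.exp (τ * β) ^ 2)⁻¹ := by
      rw [← Real.exp_nat_mul, ← Real.exp_neg]; congr 1; push_cast; ring
    rw [h5, inv_mul_le_iff₀ (by positivity)] at hfin
    refine (h4.trans hfin).trans ?_
    rw [mul_pow, mul_comm]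
    gcongr
    have : (0 : ℝ) ≤ k := by positivity
    nlinarith
  exact le_of_sq_le_sq h3 (by positivity)
end evol

/-! ### Inverse Fourier integrals with Gaussian-bounded densities, and their derivatives. -/

/-- The oscillating factor `exp (2πi⟨x, ξ⟩)`. -/
noncomputable def wave {d : ℕ} (x : Fin d → ℝ) (ξ : EuclideanSpace ℝ (Fin d)) : ℂ :=
  Complex.exp (((2 * Real.pi * ∑ l, x l * ξ l : ℝ) : ℂ) * Complex.I)

theorem norm_wave {d : ℕ} (x : Fin d → ℝ) (ξ : EuclideanSpace ℝ (Fin d)) : ‖wave x ξ‖ = 1 :=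
  Complex.norm_exp_ofReal_mul_I _

@[fun_prop]
theorem continuous_wave {d : ℕ} :
    Continuous fun q : (Fin d → ℝ) × EuclideanSpace ℝ (Fin d) => wave q.1 q.2 := by
  unfold wave; fun_prop

theorem hasDerivAt_wave {d : ℕ} (x : Fin d → ℝ) (ξ : EuclideanSpace ℝ (Fin d)) (l : Fin d)
    (y : ℝ) :
    HasDerivAt (fun y => wave (Function.update x l y) ξ)
      (wave (Function.update x l y) ξ * (2 * Real.pi * ξ l * Complex.I)) y := by
  have h1 : HasDerivAt (fun y => ∑ m, Function.update x l y m * ξ m)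
      (∑ m, if m = l then ξ l else 0) y := by
    refine HasDerivAt.fun_sum fun m _ => ?_
    by_cases hm : m = l
    · subst hm
      simpa using (hasDerivAt_id y).mul_const (ξ m)
    · simpa [hm] using hasDerivAt_const y (x m * ξ m)
  simp only [Finset.sum_ite_eq', Finset.mem_univ, if_true] at h1
  have h2 := ((h1.const_mul (2 * Real.pi)).ofReal_comp.mul_const Complex.I).cexp
  refine h2.congr_deriv ?_
  simp [wave]

/-- The inverse Fourier integral of `f` at `x`. -/
noncomputable def osc {d : ℕ} (f : EuclideanSpace ℝ (Fin d) → ℂ) (x : Fin d → ℝ) : ℂ :=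
  ∫ ξ, wave x ξ * f ξ

/-- Continuous multipliers growing slower than any Gaussian. -/
structure IsMultiplier {d : ℕ} (q : EuclideanSpace ℝ (Fin d) → ℂ) : Prop where
  cont : Continuous q
  bound : ∀ δ > 0, ∃ C, ∀ ξ, ‖q ξ‖ ≤ C * Real.exp (δ * ‖ξ‖ ^ 2)

/-- Families `w t ξ`, continuous in each variable, with Gaussian decay in `ξ` that is uniform for
`t` bounded away from `T`. -/
structure IsGaussBdd {d : ℕ} (T : ℝ) (w : ℝ → EuclideanSpace ℝ (Fin d) → ℂ) : Prop where
  cont : ∀ t, Continuous (w t)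
  cont_time : ∀ ξ, Continuous fun t => w t ξ
  bound : ∀ T' < T, ∃ C, ∃ c > 0, ∀ t ∈ Ioo 0 T', ∀ ξ, ‖w t ξ‖ ≤ C * Real.exp (-c * ‖ξ‖ ^ 2)

section multiplier

variable {d : ℕ} {q q' : EuclideanSpace ℝ (Fin d) → ℂ}

theorem IsMultiplier.const (a : ℂ) : IsMultiplier (d := d) fun _ => a where
  cont := continuous_const
  bound δ hδ := ⟨‖a‖, fun ξ => le_mul_of_one_le_right (norm_nonneg _)
    (Real.one_le_exp (by positivity))⟩

theorem IsMultiplier.add (h : IsMultiplier q) (h' : IsMultiplier q') :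
    IsMultiplier fun ξ => q ξ + q' ξ where
  cont := h.cont.add h'.cont
  bound δ hδ := by
    obtain ⟨C, hC⟩ := h.bound δ hδ
    obtain ⟨C', hC'⟩ := h'.bound δ hδ
    refine ⟨C + C', fun ξ => (norm_add_le _ _).trans ?_⟩
    rw [add_mul]
    exact add_le_add (hC ξ) (hC' ξ)

theorem IsMultiplier.mul (h : IsMultiplier q) (h' : IsMultiplier q') :
    IsMultiplier fun ξ => q ξ * q' ξ where
  cont := h.cont.mul h'.cont
  bound δ hδ := by
    obtain ⟨C, hC⟩ := h.bound (δ / 2) (by positivity)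
    obtain ⟨C', hC'⟩ := h'.bound (δ / 2) (by positivity)
    refine ⟨C * C', fun ξ => ?_⟩
    rw [norm_mul]
    calc ‖q ξ‖ * ‖q' ξ‖ ≤ (C * Real.exp (δ / 2 * ‖ξ‖ ^ 2)) * (C' * Real.exp (δ / 2 * ‖ξ‖ ^ 2)) :=
          mul_le_mul (hC ξ) (hC' ξ) (norm_nonneg _) ((norm_nonneg _).trans (hC ξ))
      _ = C * C' * (Real.exp (δ / 2 * ‖ξ‖ ^ 2) * Real.exp (δ / 2 * ‖ξ‖ ^ 2)) := by ring
      _ = C * C' * Real.exp (δ * ‖ξ‖ ^ 2) := by rw [← Real.exp_add]; ring_nf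

theorem IsMultiplier.sum {ι : Type*} {s : Finset ι} {q : ι → EuclideanSpace ℝ (Fin d) → ℂ}
    (h : ∀ a, IsMultiplier (q a)) : IsMultiplier fun ξ => ∑ a ∈ s, q a ξ := by
  classical
  induction s using Finset.induction_on with
  | empty => simpa using IsMultiplier.const 0
  | insert a s ha ih => simpa [Finset.sum_insert ha] using (h a).add ih

theorem isMultiplier_coord (l : Fin d) :
    IsMultiplier fun ξ : EuclideanSpace ℝ (Fin d) => (ξ l : ℂ) where
  cont := by fun_prop
  bound δ hδ := by
    refine ⟨1 + δ⁻¹, fun ξ => ?_⟩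
    have h1 : ‖(ξ l : ℂ)‖ ≤ ‖ξ‖ := by
      rw [Complex.norm_real]; exact PiLp.norm_apply_le ξ l
    have h2 := Real.add_one_le_exp (δ * ‖ξ‖ ^ 2)
    have h3 : ‖ξ‖ ≤ 1 + ‖ξ‖ ^ 2 := by nlinarith [sq_nonneg (‖ξ‖ - 1)]
    have h4 : ‖ξ‖ ^ 2 = δ⁻¹ * (δ * ‖ξ‖ ^ 2) := by field_simp
    have h5 : 0 ≤ δ * ‖ξ‖ ^ 2 := by positivity
    have h6 : 0 < δ⁻¹ := by positivity
    calc ‖(ξ l : ℂ)‖ ≤ 1 + δ⁻¹ * (δ * ‖ξ‖ ^ 2) := by rw [← h4]; linarith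
      _ ≤ (1 + δ⁻¹) * (δ * ‖ξ‖ ^ 2 + 1) := by nlinarith
      _ ≤ _ := by gcongr

theorem isMultiplier_cexponent (p : Fin d → ℝ) (l : Fin d) :
    IsMultiplier fun ξ => cexponent p ξ l :=
  (IsMultiplier.const _).add (((IsMultiplier.const _).mul (isMultiplier_coord l)).mul
    (IsMultiplier.const _))

theorem isMultiplier_symbol {k : ℕ} (r : Fin k → ℝ) (σ : Fin k → Matrix (Fin d) (Fin d) ℝ)
    (i : Fin k) (p : Fin d → ℝ) : IsMultiplier fun ξ => symbol r σ i (cexponent p ξ) := by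
  have h1 : ∀ l l', IsMultiplier fun ξ => (if l = l' then -cexponent p ξ l else 0) := by
    intro l l'
    split_ifs
    · simpa using (IsMultiplier.const (-1)).mul (isMultiplier_cexponent p l)
    · exact IsMultiplier.const 0
  have h2 := (((IsMultiplier.const (r i : ℂ)).mul (IsMultiplier.sum (s := Finset.univ)
    fun l => isMultiplier_cexponent p l)).add
    ((IsMultiplier.const (1 / 2)).mul (IsMultiplier.sum (s := Finset.univ) fun l =>
      IsMultiplier.sum (s := Finset.univ) fun l' =>
        (IsMultiplier.const (diffusion σ i l l' : ℂ)).mul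
          (((isMultiplier_cexponent p l).mul (isMultiplier_cexponent p l')).add (h1 l l'))))).add
    (IsMultiplier.const (-(r i : ℂ)))
  convert h2 using 2 with ξ
  simp only [symbol, sub_eq_add_neg]
  congr 4 with l
  congr 1 with l'
  split_ifs <;> simp

end multiplier

section IsGaussBdd

variable {d : ℕ} {T : ℝ} {w w' : ℝ → EuclideanSpace ℝ (Fin d) → ℂ}
  {q : EuclideanSpace ℝ (Fin d) → ℂ}

theorem integrable_gaussian {c : ℝ} (hc : 0 < c) :
    Integrable fun ξ : EuclideanSpace ℝ (Fin d) => Real.exp (-c * ‖ξ‖ ^ 2) := by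
  have := (GaussianFourier.integrable_cexp_neg_mul_sq_norm_add (b := (c : ℂ))
    (V := EuclideanSpace ℝ (Fin d)) (by simpa using hc) 0 0).norm
  refine this.congr (Eventually.of_forall fun ξ => ?_)
  simp only [Complex.norm_exp]
  congr 1
  have : (-(c : ℂ) * (‖ξ‖ : ℂ) ^ 2 + 0 * ((inner ℝ 0 ξ : ℝ) : ℂ))
    = ((-c * ‖ξ‖ ^ 2 : ℝ) : ℂ) := by push_cast; ring
  rw [this, Complex.ofReal_re]

/-- Half of the Gaussian rate is spent on absorbing the multiplier. Thus the class is stable under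
the polynomial factors that differentiation produces. -/
theorem IsGaussBdd.mul (hq : IsMultiplier q) (hw : IsGaussBdd T w) :
    IsGaussBdd T fun t ξ => q ξ * w t ξ where
  cont t := hq.cont.mul (hw.cont t)
  cont_time ξ := continuous_const.mul (hw.cont_time ξ)
  bound T' hT' := by
    obtain ⟨C, c, hc, hC⟩ := hw.bound T' hT'
    obtain ⟨C', hC'⟩ := hq.bound (c / 2) (by positivity)
    refine ⟨C' * C, c / 2, by positivity, fun t ht ξ => ?_⟩
    rw [norm_mul]
    calc ‖q ξ‖ * ‖w t ξ‖ ≤ (C' * Real.exp (c / 2 * ‖ξ‖ ^ 2)) * (C * Real.exp (-c * ‖ξ‖ ^ 2)) :=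
          mul_le_mul (hC' ξ) (hC t ht ξ) (norm_nonneg _) ((norm_nonneg _).trans (hC' ξ))
      _ = C' * C * (Real.exp (c / 2 * ‖ξ‖ ^ 2) * Real.exp (-c * ‖ξ‖ ^ 2)) := by ring
      _ = _ := by rw [← Real.exp_add]; ring_nf

theorem IsGaussBdd.add (hw : IsGaussBdd T w) (hw' : IsGaussBdd T w') :
    IsGaussBdd T fun t ξ => w t ξ + w' t ξ where
  cont t := (hw.cont t).add (hw'.cont t)
  cont_time ξ := (hw.cont_time ξ).add (hw'.cont_time ξ)
  bound T' hT' := by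
    obtain ⟨C, c, hc, hC⟩ := hw.bound T' hT'
    obtain ⟨C', c', hc', hC'⟩ := hw'.bound T' hT'
    refine ⟨|C| + |C'|, min c c', lt_min hc hc', fun t ht ξ => (norm_add_le _ _).trans ?_⟩
    rw [add_mul]
    refine add_le_add ((hC t ht ξ).trans ?_) ((hC' t ht ξ).trans ?_)
    · gcongr
      · exact le_abs_self C
      · exact min_le_left c c'
    · gcongr
      · exact le_abs_self C'
      · exact min_le_right c c'

theorem IsGaussBdd.sum {ι : Type*} {s : Finset ι} {w : ι → ℝ → EuclideanSpace ℝ (Fin d) → ℂ}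
    (h : ∀ a, IsGaussBdd T (w a)) : IsGaussBdd T fun t ξ => ∑ a ∈ s, w a t ξ := by
  classical
  induction s using Finset.induction_on with
  | empty =>
    refine ⟨fun t => by simpa using continuous_const, fun ξ => by simpa using continuous_const,
      fun T' _ => ⟨0, 1, one_pos, fun t _ ξ => by simp⟩⟩
  | insert a s ha ih => simpa [Finset.sum_insert ha] using (h a).add ih

theorem IsGaussBdd.exists_bound (hw : IsGaussBdd T w) {t : ℝ} (ht : t ∈ Ioo 0 T) :
    ∃ B : EuclideanSpace ℝ (Fin d) → ℝ, Integrable B ∧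
      ∃ I ∈ 𝓝 t, ∀ τ ∈ I, ∀ ξ, ‖w τ ξ‖ ≤ B ξ := by
  obtain ⟨T', h1, h2⟩ := exists_between ht.2
  obtain ⟨C, c, hc, hC⟩ := hw.bound T' h2
  exact ⟨_, (integrable_gaussian hc).const_mul C, Ioo 0 T', Ioo_mem_nhds ht.1 h1, hC⟩

theorem continuous_wave_left (x : Fin d → ℝ) : Continuous (wave x) := by
  unfold wave; fun_prop

theorem norm_wave_mul (x : Fin d → ℝ) (ξ : EuclideanSpace ℝ (Fin d)) (a : ℂ) :
    ‖wave x ξ * a‖ = ‖a‖ := by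
  rw [norm_mul, norm_wave, one_mul]

theorem IsGaussBdd.aestronglyMeasurable (hw : IsGaussBdd T w) (t : ℝ) (x : Fin d → ℝ) :
    AEStronglyMeasurable (fun ξ => wave x ξ * w t ξ) :=
  ((continuous_wave_left x).mul (hw.cont t)).aestronglyMeasurable

theorem IsGaussBdd.integrable (hw : IsGaussBdd T w) {t : ℝ} (ht : t ∈ Ioo 0 T)
    (x : Fin d → ℝ) : Integrable fun ξ => wave x ξ * w t ξ := by
  obtain ⟨B, hB, I, hI, hwB⟩ := hw.exists_bound ht
  refine hB.mono' (hw.aestronglyMeasurable t x) (Eventually.of_forall fun ξ => ?_)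
  rw [norm_wave_mul]
  exact hwB t (mem_of_mem_nhds hI) ξ

theorem IsGaussBdd.continuousOn_osc (hw : IsGaussBdd T w) :
    ContinuousOn (fun a : ℝ × (Fin d → ℝ) => osc (w a.1) a.2) (Ioo 0 T ×ˢ univ) := by
  intro a ha
  refine ContinuousAt.continuousWithinAt ?_
  obtain ⟨B, hB, I, hI, hwB⟩ := hw.exists_bound ha.1
  refine continuousAt_of_dominated (bound := B)
    (Eventually.of_forall fun b => hw.aestronglyMeasurable b.1 b.2) ?_ hB
    (Eventually.of_forall fun ξ => ?_)
  · filter_upwards [continuous_fst.continuousAt.preimage_mem_nhds hI] with b hb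
    refine Eventually.of_forall fun ξ => ?_
    rw [norm_wave_mul]
    exact hwB b.1 hb ξ
  · have h1 : Continuous fun b : ℝ × (Fin d → ℝ) => wave b.2 ξ * w b.1 ξ :=
      (continuous_wave.comp (continuous_snd.prodMk continuous_const)).mul
        ((hw.cont_time ξ).comp continuous_fst)
    exact h1.continuousAt

theorem IsGaussBdd.hasDerivAt_osc_time (hw : IsGaussBdd T w) (hw' : IsGaussBdd T w')
    (hd : ∀ t ξ, HasDerivAt (fun t => w t ξ) (w' t ξ) t) {t : ℝ} (ht : t ∈ Ioo 0 T)
    (x : Fin d → ℝ) : HasDerivAt (fun t => osc (w t) x) (osc (w' t) x) t := by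
  obtain ⟨B, hB, I, hI, hwB⟩ := hw'.exists_bound ht
  refine (hasDerivAt_integral_of_dominated_loc_of_deriv_le (𝕜 := ℝ) (bound := B)
    (F := fun t ξ => wave x ξ * w t ξ) (F' := fun t ξ => wave x ξ * w' t ξ) hI
    (Eventually.of_forall fun b => hw.aestronglyMeasurable b x) (hw.integrable ht x)
    (hw'.aestronglyMeasurable t x) (Eventually.of_forall fun ξ τ hτ => ?_) hB
    (Eventually.of_forall fun ξ τ _ => (hd τ ξ).const_mul _)).2
  rw [norm_wave_mul]
  exact hwB τ hτ ξ

theorem IsGaussBdd.hasDerivAt_osc_space (hw : IsGaussBdd T w) {t : ℝ} (ht : t ∈ Ioo 0 T)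
    (x : Fin d → ℝ) (l : Fin d) :
    HasDerivAt (fun y => osc (w t) (Function.update x l y))
      (osc (fun ξ => 2 * Real.pi * ξ l * Complex.I * w t ξ) x) (x l) := by
  have hm : IsMultiplier fun ξ : EuclideanSpace ℝ (Fin d) =>
      2 * (Real.pi : ℂ) * ξ l * Complex.I :=
    ((IsMultiplier.const _).mul (isMultiplier_coord l)).mul (IsMultiplier.const _)
  have hw' := IsGaussBdd.mul hm hw
  obtain ⟨B, hB, I, hI, hwB⟩ := hw'.exists_bound ht
  have h := (hasDerivAt_integral_of_dominated_loc_of_deriv_le (𝕜 := ℝ) (bound := B)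
    (F := fun y ξ => wave (Function.update x l y) ξ * w t ξ)
    (F' := fun y ξ => wave (Function.update x l y) ξ * (2 * Real.pi * ξ l * Complex.I * w t ξ))
    (x₀ := x l) univ_mem
    (Eventually.of_forall fun b => hw.aestronglyMeasurable t _) (hw.integrable ht _)
    (hw'.aestronglyMeasurable t _) (Eventually.of_forall fun ξ y _ => ?_) hB
    (Eventually.of_forall fun ξ y _ => ?_)).2
  · simp only [Function.update_eq_self] at h
    exact h
  · rw [norm_wave_mul]
    exact hwB t (mem_of_mem_nhds hI) ξ
  · exact ((hasDerivAt_wave x ξ l y).mul_const (w t ξ)).congr_deriv (by ring)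

end IsGaussBdd

/-! ### Mellin integrals and the solutions built from a single real exponent. -/

/-- The Mellin integral `Re ∫ s ^ (p + 2πiξ) f(ξ) dξ`. -/
noncomputable def mellinRe {d : ℕ} (p : Fin d → ℝ) (f : EuclideanSpace ℝ (Fin d) → ℂ)
    (s : Fin d → ℝ) : ℝ :=
  rmono p s * (osc f fun l => Real.log (s l)).re

section mellinRe

variable {d : ℕ} {T : ℝ} {w w' : ℝ → EuclideanSpace ℝ (Fin d) → ℂ} (p : Fin d → ℝ)

theorem IsGaussBdd.continuousOn_mellinRe (hw : IsGaussBdd T w) :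
    ContinuousOn (fun a : ℝ × (Fin d → ℝ) => mellinRe p (w a.1) a.2) (Ioo 0 T ×ˢ orthant d) := by
  refine ((continuousOn_rmono p).comp continuousOn_snd fun a ha => ha.2).mul ?_
  refine Complex.continuous_re.comp_continuousOn ?_
  refine hw.continuousOn_osc.comp (f := fun a : ℝ × (Fin d → ℝ) =>
    (a.1, fun l => Real.log (a.2 l))) ?_ fun a ha => ⟨ha.1, mem_univ _⟩
  refine continuousOn_fst.prodMk (continuousOn_pi.2 fun l => ?_)
  exact ContinuousOn.log (by fun_prop) fun a ha => (ha.2 l).ne'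

theorem IsGaussBdd.hasDerivAt_mellinRe_time (hw : IsGaussBdd T w) (hw' : IsGaussBdd T w')
    (hd : ∀ t ξ, HasDerivAt (fun t => w t ξ) (w' t ξ) t) {t : ℝ} (ht : t ∈ Ioo 0 T)
    (s : Fin d → ℝ) : HasDerivAt (fun t => mellinRe p (w t) s) (mellinRe p (w' t) s) t :=
  (Complex.reCLM.hasFDerivAt.comp_hasDerivAt t
    (hw.hasDerivAt_osc_time hw' hd ht fun l => Real.log (s l))).const_mul (rmono p s)

/-- The operator `s_l ∂/∂s_l` multiplies `s ^ (p + 2πiξ)` by its exponent: `p l` comes from the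
monomial in front, `2πi ξ l` from differentiating the wave under the integral. -/
theorem IsGaussBdd.hasDerivAt_mellinRe_space (hw : IsGaussBdd T w) {t : ℝ} (ht : t ∈ Ioo 0 T)
    {s : Fin d → ℝ} (hs : s ∈ orthant d) (l : Fin d) :
    HasDerivAt (fun x => mellinRe p (w t) (Function.update s l x))
      ((s l)⁻¹ * mellinRe p (fun ξ => cexponent p ξ l * w t ξ) s) (s l) := by
  set y : Fin d → ℝ := fun m => Real.log (s m) with hy
  have h1 := hw.hasDerivAt_osc_space ht y l
  have hlog : ∀ x, (fun m => Real.log (Function.update s l x m))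
      = Function.update y l (Real.log x) := by
    intro x
    ext m
    by_cases hm : m = l
    · subst hm; simp
    · simp [hm, hy]
  have h2 : HasDerivAt (fun x => osc (w t) (fun m => Real.log (Function.update s l x m)))
      ((s l)⁻¹ • osc (fun ξ => 2 * Real.pi * ξ l * Complex.I * w t ξ) y) (s l) := by
    simp only [hlog]
    exact HasDerivAt.scomp (h := Real.log) (s l) h1 (Real.hasDerivAt_log (hs l).ne')
  have h3 := (hasDerivAt_rmono p hs l).mul (Complex.reCLM.hasFDerivAt.comp_hasDerivAt (s l) h2)
  refine h3.congr_deriv ?_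
  have h4 : osc (fun ξ => cexponent p ξ l * w t ξ) y
      = p l * osc (w t) y + osc (fun ξ => 2 * Real.pi * ξ l * Complex.I * w t ξ) y := by
    have hm : IsMultiplier fun ξ : EuclideanSpace ℝ (Fin d) =>
        2 * (Real.pi : ℂ) * ξ l * Complex.I :=
      ((IsMultiplier.const _).mul (isMultiplier_coord l)).mul (IsMultiplier.const _)
    simp only [osc]
    rw [← integral_const_mul, ← integral_add ((hw.integrable ht y).const_mul _)
      ((IsGaussBdd.mul hm hw).integrable ht y)]
    refine integral_congr_ae (Eventually.of_forall fun ξ => ?_)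
    simp only [cexponent]
    ring
  simp only [mellinRe, ← hy, h4, Function.update_eq_self, Function.comp_apply,
    Complex.reCLM_apply, Complex.add_re, Complex.re_ofReal_mul, Complex.smul_re, smul_eq_mul]
  ring

end mellinRe

/-- The solution of the equation whose Fourier data along the exponents `p + 2πiξ` is `H`. -/
noncomputable def modeSol {d k : ℕ} (T : ℝ) (r : Fin k → ℝ)
    (σ : Fin k → Matrix (Fin d) (Fin d) ℝ) (Λ : Matrix (Fin k) (Fin k) ℝ) (p : Fin d → ℝ)
    (H : EuclideanSpace ℝ (Fin d) → ℂ) (t : ℝ) (s : Fin d → ℝ) (i : Fin k) : ℝ :=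
  mellinRe p (fun ξ => evol r σ Λ p (T - t) ξ i * H ξ) s

section modeSol

variable {d k : ℕ} {T : ℝ} (r : Fin k → ℝ) {σ : Fin k → Matrix (Fin d) (Fin d) ℝ}
  (Λ : Matrix (Fin k) (Fin k) ℝ) (p : Fin d → ℝ) {H : EuclideanSpace ℝ (Fin d) → ℂ}

/-- For `t < T'` the evolution has run for time at least `T - T'`, which leaves a Gaussian rate `(T
- T') * c`. Hence bounded data suffice before the terminal time. -/
theorem isGaussBdd_evol (hσ : ∀ i, IsUnit (σ i)) (hH : Continuous H)
    {D : ℝ} (hD : ∀ ξ, ‖H ξ‖ ≤ D) (i : Fin k) :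
    IsGaussBdd T fun t ξ => evol r σ Λ p (T - t) ξ i * H ξ where
  cont t := ((continuous_evol r σ Λ p i).comp (by fun_prop : Continuous
    fun ξ : EuclideanSpace ℝ (Fin d) => (T - t, ξ))).mul hH
  cont_time ξ := ((continuous_evol r σ Λ p i).comp (by fun_prop : Continuous
    fun t : ℝ => (T - t, ξ))).mul continuous_const
  bound T' hT' := by
    obtain ⟨c, hc, b, hb, hE⟩ := exists_evol_bound r σ Λ p hσ
    have hD0 : 0 ≤ D := (norm_nonneg _).trans (hD 0)
    refine ⟨(k + 1) * Real.exp (T * b) * D, (T - T') * c, mul_pos (sub_pos.2 hT') hc,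
      fun t ht ξ => ?_⟩
    rw [norm_mul]
    have h0 : 0 ≤ T - t := by linarith [ht.2]
    calc _ ≤ ((k + 1) * Real.exp ((T - t) * (b - c * ‖ξ‖ ^ 2))) * D :=
          mul_le_mul (hE _ h0 ξ i) (hD ξ) (norm_nonneg _) (by positivity)
      _ ≤ ((k + 1) * Real.exp (T * b + -((T - T') * c) * ‖ξ‖ ^ 2)) * D := by
          gcongr
          have h1 : 0 ≤ c * ‖ξ‖ ^ 2 := by positivity
          nlinarith [ht.1, ht.2]
      _ = _ := by rw [Real.exp_add]; ring

/-- Linearity of the integral, each piece being integrable by Gaussian decay. The right-hand side is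
arranged to match term by term the state-`i` differential part of `𝕃`. -/
theorem osc_symbol_mul {w : ℝ → EuclideanSpace ℝ (Fin d) → ℂ} (hw : IsGaussBdd T w) {t : ℝ}
    (ht : t ∈ Ioo 0 T) (i : Fin k) (x : Fin d → ℝ) :
    osc (fun ξ => symbol r σ i (cexponent p ξ) * w t ξ) x
      = r i * ∑ l, osc (fun ξ => cexponent p ξ l * w t ξ) x
        + ((1 / 2 : ℝ) : ℂ) * ∑ l, ∑ l', (diffusion σ i l l' : ℂ) *
          (osc (fun ξ => cexponent p ξ l * (cexponent p ξ l' * w t ξ)) x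
            - if l = l' then osc (fun ξ => cexponent p ξ l * w t ξ) x else 0)
        - r i * osc (w t) x := by
  have hI1 : ∀ l, Integrable fun ξ => wave x ξ * (cexponent p ξ l * w t ξ) := fun l =>
    (IsGaussBdd.mul (isMultiplier_cexponent p l) hw).integrable ht x
  have hI2 : ∀ l l', Integrable fun ξ =>
      wave x ξ * (cexponent p ξ l * (cexponent p ξ l' * w t ξ)) := fun l l' =>
    (IsGaussBdd.mul (isMultiplier_cexponent p l)
      (IsGaussBdd.mul (isMultiplier_cexponent p l') hw)).integrable ht x
  have hI1' : ∀ l l', Integrable fun ξ =>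
      if l = l' then wave x ξ * (cexponent p ξ l * w t ξ) else 0 := by
    intro l l'
    split_ifs
    · exact hI1 l
    · exact integrable_zero _ _ _
  have hJ : ∀ l l', ∫ ξ, (diffusion σ i l l' : ℂ) *
      (wave x ξ * (cexponent p ξ l * (cexponent p ξ l' * w t ξ))
        - if l = l' then wave x ξ * (cexponent p ξ l * w t ξ) else 0)
      = (diffusion σ i l l' : ℂ) *
          (osc (fun ξ => cexponent p ξ l * (cexponent p ξ l' * w t ξ)) x
            - if l = l' then osc (fun ξ => cexponent p ξ l * w t ξ) x else 0) := by
    intro l l'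
    rw [integral_const_mul, integral_sub (hI2 l l') (hI1' l l')]
    congr 2
    split_ifs
    · rfl
    · simp
  have hK : ∀ l l', Integrable fun ξ => (diffusion σ i l l' : ℂ) *
      (wave x ξ * (cexponent p ξ l * (cexponent p ξ l' * w t ξ))
        - if l = l' then wave x ξ * (cexponent p ξ l * w t ξ) else 0) := fun l l' =>
    ((hI2 l l').sub (hI1' l l')).const_mul _
  have hsum1 : Integrable fun ξ => (r i : ℂ) * ∑ l, wave x ξ * (cexponent p ξ l * w t ξ) :=
    (integrable_finsetSum _ fun l _ => hI1 l).const_mul _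
  have hsum2' : ∀ l, Integrable fun ξ => ∑ l', (diffusion σ i l l' : ℂ) *
      (wave x ξ * (cexponent p ξ l * (cexponent p ξ l' * w t ξ))
        - if l = l' then wave x ξ * (cexponent p ξ l * w t ξ) else 0) := fun l =>
    integrable_finsetSum _ fun l' _ => hK l l'
  have hsum2 : Integrable fun ξ => ((1 / 2 : ℝ) : ℂ) * ∑ l, ∑ l', (diffusion σ i l l' : ℂ) *
      (wave x ξ * (cexponent p ξ l * (cexponent p ξ l' * w t ξ))
        - if l = l' then wave x ξ * (cexponent p ξ l * w t ξ) else 0) :=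
    (integrable_finsetSum _ fun l _ => hsum2' l).const_mul _
  calc osc (fun ξ => symbol r σ i (cexponent p ξ) * w t ξ) x
      = ∫ ξ, (((r i : ℂ) * ∑ l, wave x ξ * (cexponent p ξ l * w t ξ)
        + ((1 / 2 : ℝ) : ℂ) * ∑ l, ∑ l', (diffusion σ i l l' : ℂ) *
          (wave x ξ * (cexponent p ξ l * (cexponent p ξ l' * w t ξ))
            - if l = l' then wave x ξ * (cexponent p ξ l * w t ξ) else 0))
        - r i * (wave x ξ * w t ξ)) := by
        refine integral_congr_ae (Eventually.of_forall fun ξ => ?_)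
        have hcoe : ∀ x : ℝ, (RCLike.ofReal x : ℂ) = Complex.ofReal x := fun _ => rfl
        have e1 : ∑ l, wave x ξ * (cexponent p ξ l * w t ξ)
            = (∑ l, cexponent p ξ l) * (wave x ξ * w t ξ) := by
          rw [Finset.sum_mul]
          exact Finset.sum_congr rfl fun l _ => by ring
        have e2 : ∑ l, ∑ l', (diffusion σ i l l' : ℂ) *
            (wave x ξ * (cexponent p ξ l * (cexponent p ξ l' * w t ξ))
              - if l = l' then wave x ξ * (cexponent p ξ l * w t ξ) else 0)
            = (∑ l, ∑ l', (diffusion σ i l l' : ℂ) * (cexponent p ξ l * cexponent p ξ l'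
              - if l = l' then cexponent p ξ l else 0)) * (wave x ξ * w t ξ) := by
          rw [Finset.sum_mul]
          refine Finset.sum_congr rfl fun l _ => ?_
          rw [Finset.sum_mul]
          refine Finset.sum_congr rfl fun l' _ => ?_
          split_ifs <;> ring
        simp only [symbol, hcoe, e1, e2]
        push_cast
        ring
    _ = _ := by
        rw [integral_sub (hsum1.fun_add hsum2) ((hw.integrable ht x).const_mul _),
          integral_add hsum1 hsum2, integral_const_mul, integral_const_mul, integral_const_mul,
          integral_finsetSum _ fun l _ => hI1 l, integral_finsetSum _ fun l _ => hsum2' l]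
        congr 3
        refine Finset.sum_congr rfl fun l _ => ?_
        rw [integral_finsetSum _ fun l' _ => hK l l']
        exact Finset.sum_congr rfl fun l' _ => hJ l l'

theorem hasC12_modeSol (hσ : ∀ i, IsUnit (σ i)) (hH : Continuous H)
    {D : ℝ} (hD : ∀ ξ, ‖H ξ‖ ≤ D) :
    HasC12 T (modeSol T r σ Λ p H)
      (fun t s i => mellinRe p (fun ξ =>
        -1 * (symbol r σ i (cexponent p ξ) * (evol r σ Λ p (T - t) ξ i * H ξ)
          + ∑ j, (Λ i j : ℂ) * (evol r σ Λ p (T - t) ξ j * H ξ))) s)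
      (fun l t s i => (s l)⁻¹ * mellinRe p (fun ξ =>
        cexponent p ξ l * (evol r σ Λ p (T - t) ξ i * H ξ)) s)
      (fun l l' t s i => (s l)⁻¹ * (s l')⁻¹ * (mellinRe p (fun ξ =>
          cexponent p ξ l * (cexponent p ξ l' * (evol r σ Λ p (T - t) ξ i * H ξ))) s
        - if l = l' then mellinRe p (fun ξ =>
          cexponent p ξ l * (evol r σ Λ p (T - t) ξ i * H ξ)) s else 0)) := by
  have hw := fun i => isGaussBdd_evol (T := T) r Λ p hσ hH hD i
  have hw1 := fun i l => IsGaussBdd.mul (isMultiplier_cexponent p l) (hw i)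
  have hw2 := fun i l l' => IsGaussBdd.mul (isMultiplier_cexponent p l) (hw1 i l')
  have hwt := fun i => IsGaussBdd.mul (IsMultiplier.const (-1))
    ((IsGaussBdd.mul (isMultiplier_symbol r σ i p) (hw i)).add (IsGaussBdd.sum
      (s := Finset.univ) fun j => IsGaussBdd.mul (IsMultiplier.const (Λ i j : ℂ)) (hw j)))
  have hinv : ∀ l, ContinuousOn (fun a : ℝ × (Fin d → ℝ) => (a.2 l)⁻¹) (Ioo 0 T ×ˢ orthant d) :=
    fun l => (continuousOn_coord_inv l).comp continuousOn_snd fun a ha => ha.2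
  refine ⟨fun t ht s hs i => ?_, fun l t ht s hs i => ?_, fun l l' t ht s hs i => ?_,
    fun i => (hwt i).continuousOn_mellinRe p,
    fun l i => (hinv l).mul ((hw1 i l).continuousOn_mellinRe p), fun l l' i => ?_⟩
  · refine (hw i).hasDerivAt_mellinRe_time p (hwt i) (fun t ξ => ?_) ht s
    have h1 : HasDerivAt (fun t : ℝ => T - t) (-1) t := by
      simpa using (hasDerivAt_id t).const_sub T
    have h2 := (HasDerivAt.scomp (h := fun t : ℝ => T - t) t
      (hasDerivAt_evol r σ Λ p (T - t) ξ i) h1).mul_const (H ξ)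
    refine h2.congr_deriv ?_
    have h3 : ∑ j, (Λ i j : ℂ) * (evol r σ Λ p (T - t) ξ j * H ξ)
        = (∑ j, (Λ i j : ℂ) * evol r σ Λ p (T - t) ξ j) * H ξ := by
      rw [Finset.sum_mul]
      exact Finset.sum_congr rfl fun j _ => by ring
    rw [h3, neg_smul, one_smul]
    ring
  · exact (hw i).hasDerivAt_mellinRe_space p ht hs l
  · have h1 := (hasDerivAt_inv_update hs l l').fun_mul
      ((hw1 i l').hasDerivAt_mellinRe_space p ht hs l)
    refine h1.congr_deriv ?_
    simp only [Function.update_eq_self]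
    by_cases h : l = l'
    · subst h; simp only [if_true]; ring
    · simp only [h, if_false]; ring
  · refine ((hinv l).mul (hinv l')).mul (((hw2 i l l').continuousOn_mellinRe p).sub ?_)
    split_ifs
    · exact (hw1 i l).continuousOn_mellinRe p
    · exact continuousOn_const

theorem modeSol_pde (hσ : ∀ i, IsUnit (σ i)) (hH : Continuous H)
    {D : ℝ} (hD : ∀ ξ, ‖H ξ‖ ≤ D) {t : ℝ} (ht : t ∈ Ioo 0 T) {s : Fin d → ℝ}
    (hs : s ∈ orthant d) (i : Fin k) :
    partialT (modeSol T r σ Λ p H) t s i + opL r σ Λ (modeSol T r σ Λ p H) t s i = 0 := by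
  have hC := hasC12_modeSol (T := T) r Λ p hσ hH hD
  rw [hC.partialT_eq ht hs, hC.opL_eq r σ Λ ht hs]
  have hw := fun i => isGaussBdd_evol (T := T) r Λ p hσ hH hD i
  set x : Fin d → ℝ := fun l => Real.log (s l) with hx
  have h1 := osc_symbol_mul r (σ := σ) p (hw i) ht i x
  have h2 : osc (fun ξ => -1 * (symbol r σ i (cexponent p ξ) * (evol r σ Λ p (T - t) ξ i * H ξ)
          + ∑ j, (Λ i j : ℂ) * (evol r σ Λ p (T - t) ξ j * H ξ))) x
      = -(osc (fun ξ => symbol r σ i (cexponent p ξ) * (evol r σ Λ p (T - t) ξ i * H ξ)) x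
        + ∑ j, (Λ i j : ℂ) * osc (fun ξ => evol r σ Λ p (T - t) ξ j * H ξ) x) := by
    have hI0 := (IsGaussBdd.mul (isMultiplier_symbol r σ i p) (hw i)).integrable ht x
    have hIj : ∀ j, Integrable fun ξ =>
        (Λ i j : ℂ) * (wave x ξ * (evol r σ Λ p (T - t) ξ j * H ξ)) :=
      fun j => ((hw j).integrable ht x).const_mul _
    simp only [osc]
    simp_rw [← integral_const_mul]
    rw [← integral_finsetSum _ fun j _ => hIj j, ← integral_add hI0
      (integrable_finsetSum _ fun j _ => hIj j), ← integral_neg]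
    refine integral_congr_ae (Eventually.of_forall fun ξ => ?_)
    simp only [mul_add, neg_add, Finset.mul_sum, ← Finset.sum_neg_distrib]
    congr 1
    · ring
    · exact Finset.sum_congr rfl fun j _ => by ring
  have hre : ∀ l l', (if l = l' then osc (fun ξ => cexponent p ξ l *
      (evol r σ Λ p (T - t) ξ i * H ξ)) x else 0).re
      = if l = l' then (osc (fun ξ => cexponent p ξ l *
      (evol r σ Λ p (T - t) ξ i * H ξ)) x).re else 0 := by
    intro l l'; split_ifs <;> simp
  simp only [jetL, modeSol, mellinRe, ← hx, h2, h1, Complex.neg_re, Complex.add_re,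
    Complex.sub_re, Complex.re_ofReal_mul, Complex.re_sum, hre]
  have e1 : ∑ l, s l * ((s l)⁻¹ * (rmono p s *
      (osc (fun ξ => cexponent p ξ l * (evol r σ Λ p (T - t) ξ i * H ξ)) x).re))
      = rmono p s * ∑ l,
        (osc (fun ξ => cexponent p ξ l * (evol r σ Λ p (T - t) ξ i * H ξ)) x).re := by
    rw [Finset.mul_sum]
    refine Finset.sum_congr rfl fun l _ => ?_
    rw [mul_inv_cancel_left₀ (hs l).ne']
  have e2 : ∑ l, ∑ l', diffusion σ i l l' * s l * s l' * ((s l)⁻¹ * (s l')⁻¹ * (rmono p s *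
        (osc (fun ξ => cexponent p ξ l * (cexponent p ξ l' *
          (evol r σ Λ p (T - t) ξ i * H ξ))) x).re
        - if l = l' then rmono p s * (osc (fun ξ => cexponent p ξ l *
          (evol r σ Λ p (T - t) ξ i * H ξ)) x).re else 0))
      = rmono p s * ∑ l, ∑ l', diffusion σ i l l' * ((osc (fun ξ => cexponent p ξ l *
        (cexponent p ξ l' * (evol r σ Λ p (T - t) ξ i * H ξ))) x).re
        - if l = l' then (osc (fun ξ => cexponent p ξ l *
          (evol r σ Λ p (T - t) ξ i * H ξ)) x).re else 0) := by
    rw [Finset.mul_sum]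
    refine Finset.sum_congr rfl fun l _ => ?_
    rw [Finset.mul_sum]
    refine Finset.sum_congr rfl fun l' _ => ?_
    have h3 := (hs l).ne'
    have h4 := (hs l').ne'
    split_ifs
    · field_simp
    · field_simp
      ring
  have e3 : ∑ j, Λ i j * (rmono p s *
        (osc (fun ξ => evol r σ Λ p (T - t) ξ j * H ξ) x).re)
      = rmono p s * ∑ j, Λ i j * (osc (fun ξ => evol r σ Λ p (T - t) ξ j * H ξ) x).re := by
    rw [Finset.mul_sum]
    exact Finset.sum_congr rfl fun j _ => by ring
  rw [e1, e2, e3]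
  ring

/-- A uniform bound on the evolution for `t ∈ (0, T]`. -/
theorem exists_evol_bound_const (hσ : ∀ i, IsUnit (σ i)) (T : ℝ) :
    ∃ C, 0 ≤ C ∧ ∀ t ∈ Ioc 0 T, ∀ ξ i, ‖evol r σ Λ p (T - t) ξ i‖ ≤ C := by
  obtain ⟨c, hc, b, hb, hE⟩ := exists_evol_bound r σ Λ p hσ
  refine ⟨(k + 1) * Real.exp (T * b), by positivity, fun t ht ξ i => ?_⟩
  have h0 : 0 ≤ T - t := by linarith [ht.2]
  refine (hE _ h0 ξ i).trans ?_
  refine mul_le_mul_of_nonneg_left (Real.exp_le_exp.2 ?_) (by positivity)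
  have h1 : 0 ≤ c * ‖ξ‖ ^ 2 := by positivity
  nlinarith [ht.1]

/-- Up to and including `T` the evolution is only uniformly bounded, so the dominating function must
come from integrability of `H`. -/
theorem jointContOn_modeSol (hσ : ∀ i, IsUnit (σ i)) (hH : Continuous H) (hHi : Integrable H) :
    JointContOn (Ioc 0 T) (modeSol T r σ Λ p H) := by
  intro i
  obtain ⟨C, hC0, hC⟩ := exists_evol_bound_const r Λ p hσ T
  refine ((continuousOn_rmono p).comp continuousOn_snd fun a ha => ha.2).mul ?_
  refine Complex.continuous_re.comp_continuousOn ?_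
  have hlog : ContinuousOn (fun a : ℝ × (Fin d → ℝ) => fun l => Real.log (a.2 l))
      (Ioc 0 T ×ˢ orthant d) :=
    continuousOn_pi.2 fun l => ContinuousOn.log (by fun_prop) fun a ha => (ha.2 l).ne'
  have hev : ∀ t, Continuous fun ξ => evol r σ Λ p (T - t) ξ i := fun t =>
    (continuous_evol r σ Λ p i).comp (by fun_prop : Continuous
      fun ξ : EuclideanSpace ℝ (Fin d) => (T - t, ξ))
  intro a ha
  refine continuousWithinAt_of_dominated (bound := fun ξ => C * ‖H ξ‖)
    (Eventually.of_forall fun b =>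
      ((continuous_wave_left _).mul ((hev b.1).mul hH)).aestronglyMeasurable) ?_
    (hHi.norm.const_mul C) (Eventually.of_forall fun ξ => ?_)
  · filter_upwards [self_mem_nhdsWithin] with b hb
    refine Eventually.of_forall fun ξ => ?_
    rw [norm_wave_mul, norm_mul]
    exact mul_le_mul_of_nonneg_right (hC _ hb.1 ξ i) (norm_nonneg _)
  · refine ContinuousWithinAt.mul ?_ (ContinuousWithinAt.mul ?_ continuousWithinAt_const)
    · have hc : Continuous fun y : Fin d → ℝ => wave y ξ :=
        continuous_wave.comp (continuous_id.prodMk continuous_const)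
      exact hc.continuousAt.comp_continuousWithinAt (hlog a ha)
    · have hc : Continuous fun b : ℝ × (Fin d → ℝ) => evol r σ Λ p (T - b.1) ξ i :=
        (continuous_evol r σ Λ p i).comp (by fun_prop : Continuous
          fun b : ℝ × (Fin d → ℝ) => (T - b.1, ξ))
      exact hc.continuousWithinAt

theorem exists_modeSol_bound (hσ : ∀ i, IsUnit (σ i)) (hHi : Integrable H) :
    ∃ A, ∀ t ∈ Ioc 0 T, ∀ s i, |modeSol T r σ Λ p H t s i| ≤ A * rmono p s := by
  obtain ⟨C, hC0, hC⟩ := exists_evol_bound_const r Λ p hσ T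
  refine ⟨∫ ξ, C * ‖H ξ‖, fun t ht s i => ?_⟩
  rw [modeSol, mellinRe, abs_mul, abs_of_pos (rmono_pos p s), mul_comm]
  refine mul_le_mul_of_nonneg_right ((Complex.abs_re_le_norm _).trans ?_) (rmono_pos p s).le
  refine norm_integral_le_of_norm_le (hHi.norm.const_mul C) (Eventually.of_forall fun ξ => ?_)
  rw [norm_wave_mul, norm_mul]
  exact mul_le_mul_of_nonneg_right (hC _ ht ξ i) (norm_nonneg _)

theorem modeSol_terminal (s : Fin d → ℝ) (i : Fin k) :
    modeSol T r σ Λ p H T s i = rmono p s * (osc H fun l => Real.log (s l)).re := by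
  simp [modeSol, mellinRe, evol_zero]

/-- Dominated convergence by the uncut integrand, which is integrable because `t < T`; `H` itself
need only be bounded. -/
theorem tendsto_modeSol (hσ : ∀ i, IsUnit (σ i)) (hH : Continuous H)
    {D : ℝ} (hD : ∀ ξ, ‖H ξ‖ ≤ D) {m : ℕ → EuclideanSpace ℝ (Fin d) → ℂ}
    (hm : ∀ n, Continuous (m n)) (hm1 : ∀ n ξ, ‖m n ξ‖ ≤ 1)
    (hlim : ∀ ξ, Tendsto (fun n => m n ξ) atTop (𝓝 1)) {t : ℝ} (ht : t ∈ Ioo 0 T)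
    (s : Fin d → ℝ) (i : Fin k) :
    Tendsto (fun n => modeSol T r σ Λ p (fun ξ => m n ξ * H ξ) t s i) atTop
      (𝓝 (modeSol T r σ Λ p H t s i)) := by
  have hw := isGaussBdd_evol (T := T) r Λ p hσ hH hD i
  refine Tendsto.const_mul _ ((Complex.continuous_re.tendsto _).comp ?_)
  refine tendsto_integral_of_dominated_convergence
    (fun ξ => ‖wave (fun l => Real.log (s l)) ξ * (evol r σ Λ p (T - t) ξ i * H ξ)‖)
    (fun n => ?_) (hw.integrable ht _).norm (fun n => Eventually.of_forall fun ξ => ?_)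
    (Eventually.of_forall fun ξ => ?_)
  · refine (((continuous_wave_left _).mul (((continuous_evol r σ Λ p i).comp (by fun_prop :
      Continuous fun ξ : EuclideanSpace ℝ (Fin d) => (T - t, ξ))).mul
        ((hm n).mul hH))).aestronglyMeasurable)
  · rw [norm_wave_mul, norm_wave_mul, norm_mul, norm_mul, norm_mul]
    gcongr
    exact mul_le_of_le_one_left (norm_nonneg _) (hm1 n ξ)
  · have := ((hlim ξ).mul_const (H ξ)).const_mul (evol r σ Λ p (T - t) ξ i)
    rw [one_mul] at this
    exact this.const_mul _

end modeSol

/-! ### Fourier transforms and mollification. -/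

theorem osc_eq_fourierInv {d : ℕ} (f : EuclideanSpace ℝ (Fin d) → ℂ)
    (x : EuclideanSpace ℝ (Fin d)) : osc f (fun l => x l) = 𝓕⁻ f x := by
  rw [Real.fourierInv_eq']
  simp only [osc, wave, smul_eq_mul, PiLp.inner_apply, RCLike.inner_apply, conj_trivial]

theorem continuous_fourier {d : ℕ} {f : EuclideanSpace ℝ (Fin d) → ℂ} (hf : Integrable f) :
    Continuous (𝓕 f) :=
  VectorFourier.fourierIntegral_continuous Real.continuous_fourierChar
    (L := innerₗ (EuclideanSpace ℝ (Fin d))) continuous_inner hf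

theorem norm_fourier_le {d : ℕ} (f : EuclideanSpace ℝ (Fin d) → ℂ)
    (ξ : EuclideanSpace ℝ (Fin d)) : ‖𝓕 f ξ‖ ≤ ∫ x, ‖f x‖ :=
  VectorFourier.norm_fourierIntegral_le_integral_norm _ _ _ _ _

/-- Mollification on the Fourier side: an integrable uniformly continuous function is the uniform
limit of the inverse Fourier integrals of `m n * 𝓕 h` for suitable integrable cutoffs `m n`. -/
theorem exists_fourier_mollifier {d : ℕ} {h : EuclideanSpace ℝ (Fin d) → ℂ}
    (hi : Integrable h) (hu : UniformContinuous h) :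
    ∃ m : ℕ → EuclideanSpace ℝ (Fin d) → ℂ, (∀ n, Continuous (m n)) ∧ (∀ n, Integrable (m n)) ∧
      (∀ n ξ, ‖m n ξ‖ ≤ 1) ∧ (∀ ξ, Tendsto (fun n => m n ξ) atTop (𝓝 1)) ∧
      ∀ δ > 0, ∀ᶠ n in atTop, ∀ x : EuclideanSpace ℝ (Fin d),
        ‖osc (fun ξ => m n ξ * 𝓕 h ξ) (fun l => x l) - h x‖ ≤ δ := by
  let φ : ℕ → ContDiffBump (0 : EuclideanSpace ℝ (Fin d)) := fun n =>
    ⟨1 / (2 * ((n : ℝ) + 1)), 1 / ((n : ℝ) + 1), by positivity, by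
      rw [div_lt_div_iff₀ (by positivity) (by positivity)]; nlinarith [n.cast_nonneg (α := ℝ)]⟩
  have hφ : Tendsto (fun n => (φ n).rOut) atTop (𝓝 0) := tendsto_one_div_add_atTop_nhds_zero_nat
  let f : ℕ → EuclideanSpace ℝ (Fin d) → ℂ := fun n x => (((φ n).normed volume x : ℝ) : ℂ)
  have hfs : ∀ n, HasCompactSupport (f n) := fun n =>
    (φ n).hasCompactSupport_normed.comp_left (g := Complex.ofReal) Complex.ofReal_zero
  have hfd : ∀ n, ContDiff ℝ (⊤ : ℕ∞) (f n) := fun n =>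
    Complex.ofRealCLM.contDiff.comp ((φ n).contDiff_normed (n := ⊤))
  have hfi : ∀ n, Integrable (f n) := fun n =>
    (hfd n).continuous.integrable_of_hasCompactSupport (hfs n)
  -- A smooth compactly supported function is Schwartz, hence so is its transform.
  have hfS : ∀ n, Integrable (𝓕 (f n)) := by
    intro n
    have h1 : ⇑((hfs n).toSchwartzMap (hfd n)) = f n := rfl
    have h2 := (𝓕 ((hfs n).toSchwartzMap (hfd n))).integrable (μ := volume)
    rw [SchwartzMap.fourier_coe, h1] at h2
    exact h2
  have hnorm : ∀ n, ∫ x, ‖f n x‖ = 1 := by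
    intro n
    have : ∀ x, ‖f n x‖ = (φ n).normed volume x := fun x => by
      rw [Complex.norm_real, Real.norm_of_nonneg ((φ n).nonneg_normed x)]
    simp_rw [this]
    exact (φ n).integral_normed
  have hconv : ∀ n (g : EuclideanSpace ℝ (Fin d) → ℂ), (f n ⋆[ContinuousLinearMap.mul ℂ ℂ] g)
      = ((φ n).normed volume ⋆[ContinuousLinearMap.lsmul ℝ ℝ] g) := by
    intro n g
    ext x
    simp [convolution, f]
  have hdist : ∀ (g : EuclideanSpace ℝ (Fin d) → ℂ), Continuous g → ∀ n (δ : ℝ) x₀,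
      (∀ x ∈ Metric.ball x₀ (φ n).rOut, dist (g x) (g x₀) ≤ δ) →
      ‖(f n ⋆[ContinuousLinearMap.mul ℂ ℂ] g) x₀ - g x₀‖ ≤ δ := by
    intro g hg n δ x₀ hb
    rw [hconv, ← dist_eq_norm]
    exact (φ n).dist_normed_convolution_le hg.aestronglyMeasurable hb
  refine ⟨fun n => 𝓕 (f n), fun n => continuous_fourier (hfi n), hfS, fun n ξ => ?_, fun ξ => ?_,
    fun δ hδ => ?_⟩
  · exact (norm_fourier_le _ _).trans_eq (hnorm n)
  · have hg : Continuous fun x : EuclideanSpace ℝ (Fin d) =>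
        ((Real.fourierChar (inner ℝ x ξ) : Circle) : ℂ) := by
      fun_prop
    -- The transform at `ξ` is the mollification of a character evaluated at `0`, so it tends to the
    -- value `1` of the character there.
    have h1 : ∀ n, 𝓕 (f n) ξ = (f n ⋆[ContinuousLinearMap.mul ℂ ℂ]
        fun x : EuclideanSpace ℝ (Fin d) => ((Real.fourierChar (inner ℝ x ξ) : Circle) : ℂ)) 0 := by
      intro n
      rw [Real.fourier_eq]
      simp only [convolution, ContinuousLinearMap.mul_apply', zero_sub, inner_neg_left]
      refine integral_congr_ae (Eventually.of_forall fun x => ?_)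
      simp only [Circle.smul_def, smul_eq_mul]
      ring
    simp_rw [h1, hconv]
    have := ContDiffBump.convolution_tendsto_right_of_continuous (μ := volume) hφ hg 0
    simpa using this
  · obtain ⟨η, hη, hηu⟩ := Metric.uniformContinuous_iff.1 hu δ hδ
    filter_upwards [hφ.eventually (gt_mem_nhds hη)] with n hn x
    have hb := hdist h hu.continuous n δ x fun y hy =>
      (hηu ((Metric.mem_ball.1 hy).trans hn)).le
    have hc : Continuous (f n ⋆[ContinuousLinearMap.mul ℂ ℂ] h) :=
      (hfs n).continuous_convolution_left _ (hfd n).continuous hi.locallyIntegrable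
    have hci : Integrable (f n ⋆[ContinuousLinearMap.mul ℂ ℂ] h) :=
      (hfi n).integrable_convolution _ hi
    -- Fourier inversion for `f n ⋆ h` identifies the cut-off integral with the mollification of
    -- `h`, which is uniformly close to `h`.
    have hF : 𝓕 (f n ⋆[ContinuousLinearMap.mul ℂ ℂ] h) = fun ξ => 𝓕 (f n) ξ * 𝓕 h ξ := by
      ext ξ
      exact Real.fourier_mul_convolution_eq (hfi n) hi ξ
    have hFi : Integrable (fun ξ => 𝓕 (f n) ξ * 𝓕 h ξ) :=
      (hfS n).mul_bdd (c := ∫ x, ‖h x‖) (continuous_fourier hi).aestronglyMeasurable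
        (Eventually.of_forall fun ξ => norm_fourier_le h ξ)
    have hinv := congrFun (hc.fourierInv_fourier_eq hci (by rw [hF]; exact hFi)) x
    rw [osc_eq_fourierInv, ← hF, hinv]
    exact hb

/-! ### Linearity of the equation and comparison with linear growth. -/

/-- Solutions of the equation, continuous up to the terminal time. -/
structure IsSol {d k : ℕ} (T : ℝ) (r : Fin k → ℝ) (σ : Fin k → Matrix (Fin d) (Fin d) ℝ)
    (Λ : Matrix (Fin k) (Fin k) ℝ) (u : ℝ → (Fin d → ℝ) → Fin k → ℝ) : Prop where
  contDiff : IsC12 T u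
  cont : JointContOn (Ioc 0 T) u
  pde : ∀ t ∈ Ioo 0 T, ∀ s ∈ orthant d, ∀ i, partialT u t s i + opL r σ Λ u t s i = 0

section IsSol

variable {d k : ℕ} {T : ℝ} {r : Fin k → ℝ} {σ : Fin k → Matrix (Fin d) (Fin d) ℝ}
  {Λ : Matrix (Fin k) (Fin k) ℝ} {u v : ℝ → (Fin d → ℝ) → Fin k → ℝ}

theorem IsClassicalSolution.isSol {K : (Fin d → ℝ) → ℝ} (h : IsClassicalSolution T r σ Λ K u) :
    IsSol T r σ Λ u := ⟨h.contDiff, h.cont, h.pde⟩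

theorem IsSol.sub (hu : IsSol T r σ Λ u) (hv : IsSol T r σ Λ v) : IsSol T r σ Λ (u - v) where
  contDiff := (hu.contDiff.hasC12.sub hv.contDiff.hasC12).isC12
  cont i := (hu.cont i).sub (hv.cont i)
  pde t ht s hs i := by
    have h := hu.contDiff.hasC12.sub hv.contDiff.hasC12
    have h1 := hu.pde t ht s hs i
    have h2 := hv.pde t ht s hs i
    rw [hu.contDiff.hasC12.opL_eq r σ Λ ht hs] at h1
    rw [hv.contDiff.hasC12.opL_eq r σ Λ ht hs] at h2
    rw [h.partialT_eq ht hs, h.opL_eq r σ Λ ht hs, jetL_sub]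
    simp only [Pi.sub_apply]
    linarith

theorem isSol_zero : IsSol T r σ Λ 0 := by
  have h : HasC12 (d := d) (k := k) T 0 0 0 0 :=
    ⟨fun t _ s _ i => hasDerivAt_const t 0, fun l t _ s _ i => hasDerivAt_const (s l) 0,
      fun l l' t _ s _ i => hasDerivAt_const (s l) 0, fun i => continuousOn_const,
      fun l i => continuousOn_const, fun l l' i => continuousOn_const⟩
  refine ⟨h.isC12, fun i => continuousOn_const, fun t ht s hs i => ?_⟩
  rw [h.partialT_eq ht hs, h.opL_eq r σ Λ ht hs]
  simp [jetL]

/-- The comparison principle for barriers `A (1 + ‖s‖₁) + δ ∏ (s_l ^ 2 + s_l ^ (-2))`. -/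
theorem exists_comparison_linear_barrier (hr : ∀ i, 0 ≤ r i) (hΛ : IsRateMatrix Λ) (T : ℝ)
    (σ : Fin k → Matrix (Fin d) (Fin d) ℝ) :
    ∃ G : ℝ, 1 ≤ G ∧ ∀ A δ : ℝ, 0 ≤ A → 0 ≤ δ → ∀ u, IsSol T r σ Λ u →
      (∃ B, ∀ t ∈ Ioo 0 T, ∀ s ∈ orthant d, ∀ i, u t s i ≤ B * barrier 2 s) →
      (∀ s ∈ orthant d, ∀ i, u T s i ≤ A * (1 + ∑ l, s l) + δ * barrier 2 s) →
      ∀ t ∈ Ioc 0 T, ∀ s ∈ orthant d, ∀ i,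
        u t s i ≤ G * (A * (1 + ∑ l, s l) + δ * barrier 2 s) := by
  -- The exponent at `none` gives the constant `1`, at `some l` the coordinate `s l`, and the sign
  -- patterns give `barrier 2`.
  set q : Option (Fin d) ⊕ (Fin d → Bool) → Fin d → ℝ :=
    Sum.elim (fun o => o.elim 0 fun l => Pi.single l 1) (signExp 2) with hq
  obtain ⟨γ, hγ, hcomp⟩ := exists_comparison T hr σ hΛ q
  refine ⟨Real.exp (γ * |T|), Real.one_le_exp (by positivity),
    fun A δ hA hδ u hu ⟨B, hB⟩ hterm t ht s hs i => ?_⟩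
  have hsum : ∀ s ∈ orthant d, ∑ a, (Sum.elim (fun _ => A) (fun _ => δ) a) * rmono (q a) s
      = A * (1 + ∑ l, s l) + δ * barrier 2 s := by
    intro s hs
    rw [Fintype.sum_sum_type, Fintype.sum_option]
    have h1 : ∀ l, rmono (Pi.single l 1) s = s l := by
      intro l
      simp [rmono, Pi.single_apply, Real.exp_log (hs l)]
    simp only [hq, Sum.elim_inl, Sum.elim_inr, Option.elim, h1, barrier, Finset.mul_sum, mul_add,
      mul_one]
    simp [rmono]
  have h := hcomp (Sum.elim (fun _ => A) (fun _ => δ)) (by rintro (a | a) <;> simpa) u hu.contDiff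
    hu.cont hu.pde B hB (fun s hs i => by rw [hsum s hs]; exact hterm s hs i) t ht s hs i
  rw [hsum s hs] at h
  refine h.trans ?_
  have hpos : 0 ≤ A * (1 + ∑ l, s l) + δ * barrier 2 s :=
    add_nonneg (mul_nonneg hA (add_nonneg zero_le_one (Finset.sum_nonneg fun l _ => (hs l).le)))
      (mul_nonneg hδ (barrier_pos 2 s).le)
  refine mul_le_mul_of_nonneg_right (Real.exp_le_exp.2 (mul_le_mul_of_nonneg_left ?_ hγ)) hpos
  linarith [le_abs_self T, ht.1]

end IsSol

theorem one_add_sum_le_prod {ι : Type*} (S : Finset ι) {a : ι → ℝ} (ha : ∀ l, 0 ≤ a l) :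
    1 + ∑ l ∈ S, a l ≤ ∏ l ∈ S, (1 + a l) := by
  classical
  induction S using Finset.induction_on with
  | empty => simp
  | insert l S hl ih =>
    rw [Finset.sum_insert hl, Finset.prod_insert hl]
    have h1 : 0 ≤ ∑ l ∈ S, a l := Finset.sum_nonneg fun l _ => ha l
    nlinarith [ha l, mul_nonneg (ha l) h1]

theorem one_add_sum_le_barrier {d : ℕ} {s : Fin d → ℝ} (hs : s ∈ orthant d) :
    1 + ∑ l, s l ≤ 2 ^ d * barrier 2 s := by
  refine (one_add_sum_le_prod _ fun l => (hs l).le).trans ?_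
  have h2 : (2 : ℝ) ^ d = ∏ _l : Fin d, 2 := by simp
  rw [barrier_eq_prod, h2, ← Finset.prod_mul_distrib]
  refine Finset.prod_le_prod (fun l _ => by linarith [hs l]) fun l _ => ?_
  have h1 : Real.exp (2 * Real.log (s l)) = s l ^ 2 := by
    rw [← Real.exp_log (hs l), Real.log_exp, ← Real.exp_nat_mul]; norm_num
  have h3 := one_le_barrier_factor 2 (Real.log (s l))
  rw [h1] at h3 ⊢
  have h4 := Real.exp_pos (-2 * Real.log (s l))
  nlinarith [sq_nonneg (s l - 1)]

/-! ### The payoff in logarithmic coordinates. -/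

section payoff

variable {d : ℕ} {K : (Fin d → ℝ) → ℝ}

/-- Comparison with the value at `(1, …, 1)`, whose sup-norm distance from `s` is at most `1 + ∑ l,
s l`. -/
theorem exists_linear_growth (hK_lip : ∃ L : ℝ≥0, LipschitzOnWith L K (orthant d)) :
    ∃ A, 0 ≤ A ∧ ∀ s ∈ orthant d, |K s| ≤ A * (1 + ∑ l, s l) := by
  obtain ⟨L, hL⟩ := hK_lip
  have h1 : (fun _ => 1 : Fin d → ℝ) ∈ orthant d := fun l => one_pos
  refine ⟨|K fun _ => 1| + L, by positivity, fun s hs => ?_⟩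
  have hsum : 0 ≤ ∑ l, s l := Finset.sum_nonneg fun l _ => (hs l).le
  have h2 := hL.dist_le_mul s hs _ h1
  have h3 : dist s (fun _ => 1) ≤ 1 + ∑ l, s l := by
    rw [dist_pi_le_iff (by linarith)]
    intro l
    have := Finset.single_le_sum (fun l _ => (hs l).le) (Finset.mem_univ l)
    rw [Real.dist_eq, abs_le]
    constructor <;> linarith [hs l]
  rw [Real.dist_eq] at h2
  have h4 : |K s| ≤ |K s - K fun _ => 1| + |K fun _ => 1| := by
    simpa using abs_add_le (K s - K fun _ => 1) (K fun _ => 1)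
  have h5 := mul_le_mul_of_nonneg_left h3 L.coe_nonneg
  have h6 : 0 ≤ |K fun _ => 1| * ∑ l, s l := by positivity
  nlinarith

/-- The payoff in logarithmic coordinates, divided by the barrier. -/
noncomputable def scaledPayoff (K : (Fin d → ℝ) → ℝ) (x : EuclideanSpace ℝ (Fin d)) : ℂ :=
  ((K (fun l => Real.exp (x l)) / barrier 2 (fun l => Real.exp (x l)) : ℝ) : ℂ)

theorem continuous_scaledPayoff (hK : ContinuousOn K (orthant d)) :
    Continuous (scaledPayoff K) := by
  have he : Continuous fun (x : EuclideanSpace ℝ (Fin d)) (l : Fin d) => Real.exp (x l) := by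
    fun_prop
  have hm : ∀ x : EuclideanSpace ℝ (Fin d), (fun l => Real.exp (x l)) ∈ orthant d :=
    fun x l => Real.exp_pos _
  refine Complex.continuous_ofReal.comp (Continuous.div (hK.comp_continuous he hm)
    ((continuousOn_barrier 2).comp_continuous he hm) fun x => (barrier_pos _ _).ne')

/-- The left side is at most `2 exp |x|`, while the barrier factor is at least `exp (2|x|)`; the
spare `exp |x|` beats `(1 + x ^ 2) / 2`. This is why exponent `2` yields an integrable quotient. -/
theorem payoff_factor_le (x : ℝ) :
    1 + Real.exp x ≤ 4 * (1 + x ^ 2)⁻¹ * (Real.exp (2 * x) + Real.exp (-2 * x)) := by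
  have h1 : 1 + Real.exp x ≤ 2 * Real.exp |x| := by
    have := Real.one_le_exp (abs_nonneg x)
    have := Real.exp_le_exp.2 (le_abs_self x)
    linarith
  have h2 : Real.exp |x| * Real.exp |x| ≤ Real.exp (2 * x) + Real.exp (-2 * x) := by
    rw [← Real.exp_add]
    rcases abs_cases x with ⟨h, _⟩ | ⟨h, _⟩ <;> rw [h]
    · have := Real.exp_pos (-2 * x)
      have h3 : x + x = 2 * x := by ring
      rw [h3]; linarith
    · have := Real.exp_pos (2 * x)
      have h3 : -x + -x = -2 * x := by ring
      rw [h3]; linarith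
  have h3 : (1 + x ^ 2) ≤ 2 * Real.exp |x| := by
    have := Real.quadratic_le_exp_of_nonneg (abs_nonneg x)
    rw [sq_abs] at this
    linarith [abs_nonneg x]
  have h4 : 0 < 1 + x ^ 2 := by positivity
  have h5 := Real.exp_pos |x|
  calc 1 + Real.exp x ≤ 2 * Real.exp |x| := h1
    _ ≤ 4 * (1 + x ^ 2)⁻¹ * (Real.exp |x| * Real.exp |x|) := by
        rw [mul_assoc, mul_comm (1 + x ^ 2)⁻¹, ← div_eq_mul_inv, mul_div_assoc', le_div_iff₀ h4]
        nlinarith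
    _ ≤ _ := by gcongr

theorem norm_scaledPayoff_le {A : ℝ} (hA : 0 ≤ A)
    (hKA : ∀ s ∈ orthant d, |K s| ≤ A * (1 + ∑ l, s l)) (x : EuclideanSpace ℝ (Fin d)) :
    ‖scaledPayoff K x‖ ≤ A * ∏ l, 4 * (1 + x l ^ 2)⁻¹ := by
  rw [scaledPayoff, Complex.norm_real, Real.norm_eq_abs, abs_div, abs_of_pos (barrier_pos _ _),
    div_le_iff₀ (barrier_pos _ _)]
  refine (hKA _ fun l => Real.exp_pos _).trans ?_
  rw [mul_assoc]
  refine mul_le_mul_of_nonneg_left ?_ hA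
  refine (one_add_sum_le_prod _ fun l => (Real.exp_pos _).le).trans ?_
  rw [barrier_eq_prod, ← Finset.prod_mul_distrib]
  refine Finset.prod_le_prod (fun l _ => by positivity) fun l _ => ?_
  rw [Real.log_exp]
  exact payoff_factor_le (x l)

theorem integrable_scaledPayoff (hK : ContinuousOn K (orthant d)) {A : ℝ} (hA : 0 ≤ A)
    (hKA : ∀ s ∈ orthant d, |K s| ≤ A * (1 + ∑ l, s l)) : Integrable (scaledPayoff K) := by
  have h1 : Integrable fun y : Fin d → ℝ => ∏ l, 4 * (1 + y l ^ 2)⁻¹ :=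
    Integrable.fintype_prod (f := fun _ : Fin d => fun y : ℝ => 4 * (1 + y ^ 2)⁻¹)
      fun l => integrable_inv_one_add_sq.const_mul 4
  have h2 := (PiLp.volume_preserving_ofLp (Fin d)).integrable_comp_of_integrable h1
  exact (h2.const_mul A).mono' (continuous_scaledPayoff hK).aestronglyMeasurable
    (Eventually.of_forall fun x => norm_scaledPayoff_le hA hKA x)

/-- A continuous function vanishing at infinity is uniformly continuous; the decay comes from `1 +
‖x‖ ^ 2 ≤ ∏ (1 + x_l ^ 2)`. -/
theorem uniformContinuous_scaledPayoff (hK : ContinuousOn K (orthant d)) {A : ℝ} (hA : 0 ≤ A)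
    (hKA : ∀ s ∈ orthant d, |K s| ≤ A * (1 + ∑ l, s l)) :
    UniformContinuous (scaledPayoff K) := by
  refine (continuous_scaledPayoff hK).uniformContinuous_of_tendsto_cocompact (x := 0) ?_
  have h1 : ∀ x : EuclideanSpace ℝ (Fin d),
      ‖scaledPayoff K x‖ ≤ A * 4 ^ d * (1 + ‖x‖ ^ 2)⁻¹ := by
    intro x
    refine (norm_scaledPayoff_le hA hKA x).trans ?_
    rw [Finset.prod_mul_distrib, Finset.prod_inv_distrib, Finset.prod_const, Finset.card_univ,
      Fintype.card_fin, ← mul_assoc]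
    refine mul_le_mul_of_nonneg_left ?_ (by positivity)
    rw [EuclideanSpace.real_norm_sq_eq]
    have := one_add_sum_le_prod Finset.univ fun l => sq_nonneg (x l)
    gcongr
  refine squeeze_zero_norm h1 ?_
  have h2 : Tendsto (fun x : EuclideanSpace ℝ (Fin d) => 1 + ‖x‖ ^ 2) (cocompact _) atTop :=
    tendsto_atTop_add_const_left _ _
      ((tendsto_pow_atTop two_ne_zero).comp tendsto_norm_cocompact_atTop)
  simpa using (tendsto_inv_atTop_zero.comp h2).const_mul (A * 4 ^ d)

end payoff

/-! ### Assembling the solution from its modes. -/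

/-- The sum of the mode solutions over the exponents of `barrier 2`. -/
noncomputable def fullSol {d k : ℕ} (T : ℝ) (r : Fin k → ℝ)
    (σ : Fin k → Matrix (Fin d) (Fin d) ℝ) (Λ : Matrix (Fin k) (Fin k) ℝ)
    (H : EuclideanSpace ℝ (Fin d) → ℂ) (t : ℝ) (s : Fin d → ℝ) (i : Fin k) : ℝ :=
  ∑ ε : Fin d → Bool, modeSol T r σ Λ (signExp 2 ε) H t s i

section fullSol

variable {d k : ℕ} {T : ℝ} (r : Fin k → ℝ) {σ : Fin k → Matrix (Fin d) (Fin d) ℝ}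
  (Λ : Matrix (Fin k) (Fin k) ℝ) {H : EuclideanSpace ℝ (Fin d) → ℂ}

theorem isC12_fullSol (hσ : ∀ i, IsUnit (σ i)) (hH : Continuous H)
    {D : ℝ} (hD : ∀ ξ, ‖H ξ‖ ≤ D) : IsC12 T (fullSol T r σ Λ H) :=
  (HasC12.sum fun ε => (hasC12_modeSol (T := T) r Λ (signExp 2 ε) hσ hH hD)).isC12

theorem fullSol_pde (hσ : ∀ i, IsUnit (σ i)) (hH : Continuous H)
    {D : ℝ} (hD : ∀ ξ, ‖H ξ‖ ≤ D) {t : ℝ} (ht : t ∈ Ioo 0 T) {s : Fin d → ℝ}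
    (hs : s ∈ orthant d) (i : Fin k) :
    partialT (fullSol T r σ Λ H) t s i + opL r σ Λ (fullSol T r σ Λ H) t s i = 0 := by
  have hm := fun ε : Fin d → Bool =>
    (hasC12_modeSol (T := T) r Λ (signExp 2 ε) hσ hH hD).isC12.hasC12
  have hC : HasC12 T (fullSol T r σ Λ H) _ _ _ := HasC12.sum hm
  rw [hC.partialT_eq ht hs, hC.opL_eq r σ Λ ht hs]
  refine (congrArg _ (jetL_sum _ _ _ r σ Λ t s i)).trans ?_
  rw [← Finset.sum_add_distrib]
  refine Finset.sum_eq_zero fun ε _ => ?_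
  rw [← (hm ε).opL_eq r σ Λ ht hs]
  exact modeSol_pde r Λ (signExp 2 ε) hσ hH hD ht hs i

theorem isSol_fullSol (hσ : ∀ i, IsUnit (σ i)) (hH : Continuous H) (hHi : Integrable H)
    {D : ℝ} (hD : ∀ ξ, ‖H ξ‖ ≤ D) : IsSol T r σ Λ (fullSol T r σ Λ H) where
  contDiff := isC12_fullSol r Λ hσ hH hD
  cont i := continuousOn_finsetSum _ fun ε _ => jointContOn_modeSol r Λ (signExp 2 ε) hσ hH hHi i
  pde _ ht _ hs i := fullSol_pde r Λ hσ hH hD ht hs i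

theorem exists_fullSol_bound (hσ : ∀ i, IsUnit (σ i)) (hHi : Integrable H) :
    ∃ B, ∀ t ∈ Ioc 0 T, ∀ s i, |fullSol T r σ Λ H t s i| ≤ B * barrier 2 s := by
  choose A hA using fun ε : Fin d → Bool =>
    exists_modeSol_bound (T := T) r Λ (signExp 2 ε) hσ hHi
  refine ⟨∑ ε, |A ε|, fun t ht s i => (Finset.abs_sum_le_sum_abs _ _).trans ?_⟩
  rw [barrier, Finset.mul_sum]
  refine Finset.sum_le_sum fun ε _ => (hA ε t ht s i).trans ?_
  refine mul_le_mul_of_nonneg_right ((le_abs_self _).trans ?_) (rmono_pos _ _).le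
  exact Finset.single_le_sum (fun ε _ => abs_nonneg (A ε)) (Finset.mem_univ ε)

theorem fullSol_terminal (s : Fin d → ℝ) (i : Fin k) :
    fullSol T r σ Λ H T s i = barrier 2 s * (osc H fun l => Real.log (s l)).re := by
  simp only [fullSol, modeSol_terminal, barrier, Finset.sum_mul]

/-- At time `T` the modes share the same oscillatory integral, so their monomials add up to `barrier
2`, undoing the division in `scaledPayoff`. -/
theorem abs_fullSol_terminal_sub_le {K : (Fin d → ℝ) → ℝ} {δ : ℝ}
    (hosc : ∀ x : EuclideanSpace ℝ (Fin d), ‖osc H (fun l => x l) - scaledPayoff K x‖ ≤ δ)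
    {s : Fin d → ℝ} (hs : s ∈ orthant d) (i : Fin k) :
    |fullSol T r σ Λ H T s i - K s| ≤ δ * barrier 2 s := by
  have h1 := hosc (WithLp.toLp 2 fun l => Real.log (s l))
  have h2 : (fun l => Real.exp ((WithLp.toLp 2 fun l => Real.log (s l) :
      EuclideanSpace ℝ (Fin d)) l)) = s := by
    ext l; exact Real.exp_log (hs l)
  rw [scaledPayoff, h2] at h1
  have hb := barrier_pos 2 s
  have h3 : fullSol T r σ Λ H T s i - K s = barrier 2 s *
      (osc H (fun l => Real.log (s l)) - ((K s / barrier 2 s : ℝ) : ℂ)).re := by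
    rw [fullSol_terminal, Complex.sub_re, Complex.ofReal_re, mul_sub,
      mul_div_cancel₀ _ hb.ne']
  rw [h3, abs_mul, abs_of_pos hb, mul_comm]
  exact mul_le_mul_of_nonneg_right ((Complex.abs_re_le_norm _).trans h1) hb.le

end fullSol

/-! ### Passage to the limit, existence and uniqueness. -/

section congr

variable {d k : ℕ} {T : ℝ} {φ φt ψ : ℝ → (Fin d → ℝ) → Fin k → ℝ}
  {φs : Fin d → ℝ → (Fin d → ℝ) → Fin k → ℝ}
  {φss : Fin d → Fin d → ℝ → (Fin d → ℝ) → Fin k → ℝ}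

/-- Agreement is needed on the open time interval only, which leaves the value at `T` free to be
prescribed. -/
theorem HasC12.congr (h : HasC12 T φ φt φs φss) (heq : ∀ t ∈ Ioo 0 T, ψ t = φ t) :
    HasC12 T ψ φt φs φss where
  time t ht s hs i := by
    refine (h.time t ht s hs i).congr_of_eventuallyEq ?_
    filter_upwards [Ioo_mem_nhds ht.1 ht.2] with τ hτ
    rw [heq τ hτ]
  space l t ht s hs i := by
    rw [heq t ht]
    exact h.space l t ht s hs i
  space_space := h.space_space
  cont_time := h.cont_time
  cont_space := h.cont_space
  cont_space_space := h.cont_space_space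

theorem HasC12.pde_congr (h : HasC12 T φ φt φs φss) (heq : ∀ t ∈ Ioo 0 T, ψ t = φ t)
    (r : Fin k → ℝ) (σ : Fin k → Matrix (Fin d) (Fin d) ℝ) (Λ : Matrix (Fin k) (Fin k) ℝ) {t : ℝ}
    (ht : t ∈ Ioo 0 T) {s : Fin d → ℝ} (hs : s ∈ orthant d) (i : Fin k) :
    partialT ψ t s i + opL r σ Λ ψ t s i = partialT φ t s i + opL r σ Λ φ t s i := by
  have h' := h.congr heq
  rw [h'.partialT_eq ht hs, h.partialT_eq ht hs, h'.opL_eq r σ Λ ht hs, h.opL_eq r σ Λ ht hs]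
  simp only [jetL, heq t ht]

end congr

section existence

variable {d k : ℕ} {T : ℝ} {r : Fin k → ℝ} {σ : Fin k → Matrix (Fin d) (Fin d) ℝ}
  {Λ : Matrix (Fin k) (Fin k) ℝ} {K : (Fin d → ℝ) → ℝ}

/-- If solutions converge to `φ` before the terminal time and to `K` at the terminal time,
uniformly with respect to `barrier 2`, then `φ` extended by `K` at the terminal time is
continuous and grows linearly. -/
theorem continuous_and_growth_of_tendsto (hT : 0 < T) (hr : ∀ i, 0 ≤ r i) (hΛ : IsRateMatrix Λ)
    {A : ℝ} (hA : 0 ≤ A) (hKA : ∀ s ∈ orthant d, |K s| ≤ A * (1 + ∑ l, s l))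
    {u : ℕ → ℝ → (Fin d → ℝ) → Fin k → ℝ} {φ : ℝ → (Fin d → ℝ) → Fin k → ℝ}
    (hu : ∀ n, IsSol T r σ Λ (u n))
    (hub : ∀ n, ∃ B, ∀ t ∈ Ioc 0 T, ∀ s i, |u n t s i| ≤ B * barrier 2 s)
    (hlim : ∀ t ∈ Ioo 0 T, ∀ s i, Tendsto (fun n => u n t s i) atTop (𝓝 (φ t s i)))
    (hφT : ∀ s i, φ T s i = K s)
    (hterm : ∀ δ > 0, ∀ᶠ n in atTop, ∀ s ∈ orthant d, ∀ i, |u n T s i - K s| ≤ δ * barrier 2 s) :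
    JointContOn (Ioc 0 T) φ ∧
      ∃ M, ∀ t ∈ Ioo 0 T, ∀ s ∈ orthant d, ∀ i, |φ t s i| ≤ M * (1 + ∑ l, s l) := by
  obtain ⟨G, hG1, hG⟩ := exists_comparison_linear_barrier hr hΛ T σ
  have hG0 : 0 < G := by linarith
  have hclose : ∀ δ > 0, ∀ᶠ n in atTop, ∀ t ∈ Ioc 0 T, ∀ s ∈ orthant d, ∀ i,
      |u n t s i - φ t s i| ≤ δ * barrier 2 s := by
    intro δ hδ
    -- Two terminal errors of size `η` add up, and comparison multiplies them by `G`.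
    set η := δ / (2 * G) with hη
    have hη0 : 0 < η := by positivity
    have hηδ : G * (2 * η) = δ := by rw [hη]; field_simp
    obtain ⟨N, hN⟩ := eventually_atTop.1 (hterm η hη0)
    have hdiff : ∀ n ≥ N, ∀ m ≥ N, ∀ t ∈ Ioc 0 T, ∀ s ∈ orthant d, ∀ i,
        u n t s i - u m t s i ≤ δ * barrier 2 s := by
      intro n hn m hm t ht s hs i
      obtain ⟨B, hB⟩ := hub n
      obtain ⟨B', hB'⟩ := hub m
      have := hG 0 (2 * η) le_rfl (by positivity) (u n - u m) ((hu n).sub (hu m))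
        ⟨B + B', fun t ht s hs i => by
          have h1 := abs_le.1 (hB t ⟨ht.1, ht.2.le⟩ s i)
          have h2 := abs_le.1 (hB' t ⟨ht.1, ht.2.le⟩ s i)
          simp only [Pi.sub_apply]
          rw [add_mul]
          linarith [h1.2, h2.1]⟩
        (fun s hs i => by
          have h1 := abs_le.1 (hN n hn s hs i)
          have h2 := abs_le.1 (hN m hm s hs i)
          simp only [Pi.sub_apply]
          linarith [h1.2, h2.1]) t ht s hs i
      simp only [Pi.sub_apply, zero_mul, zero_add, ← mul_assoc] at this
      rwa [mul_assoc G, hηδ] at this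
    filter_upwards [eventually_ge_atTop N] with n hn t ht s hs i
    rcases eq_or_lt_of_le ht.2 with rfl | htT
    · rw [hφT]
      refine (hN n hn s hs i).trans (mul_le_mul_of_nonneg_right ?_ (barrier_pos _ _).le)
      nlinarith
    · have h1 : Tendsto (fun m => |u n t s i - u m t s i|) atTop (𝓝 |u n t s i - φ t s i|) :=
        (tendsto_const_nhds.sub (hlim t ⟨ht.1, htT⟩ s i)).abs
      refine le_of_tendsto h1 ?_
      filter_upwards [eventually_ge_atTop N] with m hm
      rw [abs_le]
      have h2 := hdiff n hn m hm t ht s hs i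
      have h3 := hdiff m hm n hn t ht s hs i
      constructor <;> linarith
  constructor
  · intro i
    have hbc : ContinuousOn (fun a : ℝ × (Fin d → ℝ) => barrier 2 a.2) (Ioc 0 T ×ˢ orthant d) :=
      (continuousOn_barrier 2).comp continuousOn_snd fun a ha => ha.2
    -- Dividing by the barrier turns the weighted estimate into uniform convergence, which preserves
    -- continuity up to `T`.
    have hunif : TendstoUniformlyOn
        (fun n (a : ℝ × (Fin d → ℝ)) => u n a.1 a.2 i / barrier 2 a.2)
        (fun a => φ a.1 a.2 i / barrier 2 a.2) atTop (Ioc 0 T ×ˢ orthant d) := by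
      rw [Metric.tendstoUniformlyOn_iff]
      intro δ hδ
      filter_upwards [hclose (δ / 2) (by positivity)] with n hn a ha
      have h1 := hn a.1 ha.1 a.2 ha.2 i
      have hb := barrier_pos 2 a.2
      rw [dist_comm, Real.dist_eq, ← sub_div, abs_div, abs_of_pos hb, div_lt_iff₀ hb]
      nlinarith
    have hq := hunif.continuousOn (Frequently.of_forall fun n =>
      ((hu n).cont i).div hbc fun a _ => (barrier_pos _ _).ne')
    refine (hq.mul hbc).congr fun a _ => ?_
    rw [Pi.mul_apply, div_mul_cancel₀ _ (barrier_pos _ _).ne']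
  · refine ⟨G * A, fun t ht s hs i => ?_⟩
    have htc : t ∈ Ioc 0 T := ⟨ht.1, ht.2.le⟩
    have hTc : T ∈ Ioc 0 T := ⟨hT, le_rfl⟩
    -- `G` does not depend on `δ`, so the barrier term disappears as `δ → 0` and only linear growth
    -- remains.
    have key : ∀ δ > 0, |φ t s i| ≤ G * (A * (1 + ∑ l, s l) + δ * barrier 2 s) := by
      intro δ hδ
      refine le_of_tendsto (hlim t ht s i).abs ?_
      filter_upwards [hterm δ hδ] with n hn
      obtain ⟨B, hB⟩ := hub n
      rw [abs_le]
      constructor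
      · have := hG A δ hA hδ.le (0 - u n) (isSol_zero.sub (hu n))
          ⟨B, fun t ht s hs i => by
            have h1 := abs_le.1 (hB t ⟨ht.1, ht.2.le⟩ s i)
            simp only [Pi.sub_apply, Pi.zero_apply]
            linarith [h1.1]⟩
          (fun s hs i => by
            have h1 := abs_le.1 (hn s hs i)
            have h2 := abs_le.1 (hKA s hs)
            simp only [Pi.sub_apply, Pi.zero_apply]
            linarith [h1.1, h2.1]) t htc s hs i
        simp only [Pi.sub_apply, Pi.zero_apply] at this
        linarith
      · exact hG A δ hA hδ.le (u n) (hu n)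
          ⟨B, fun t ht s hs i => (le_abs_self _).trans (hB t ⟨ht.1, ht.2.le⟩ s i)⟩
          (fun s hs i => by
            have h1 := abs_le.1 (hn s hs i)
            have h2 := abs_le.1 (hKA s hs)
            linarith [h1.2, h2.2]) t htc s hs i
    have hl : Tendsto (fun δ : ℝ => G * (A * (1 + ∑ l, s l) + δ * barrier 2 s)) (𝓝[>] 0)
        (𝓝 (G * A * (1 + ∑ l, s l))) := by
      have hc : Continuous fun δ : ℝ => G * (A * (1 + ∑ l, s l) + δ * barrier 2 s) := by fun_prop
      have := hc.tendsto 0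
      simp only [zero_mul, add_zero, ← mul_assoc] at this
      simpa only [mul_assoc] using this.mono_left nhdsWithin_le_nhds
    exact ge_of_tendsto hl (by filter_upwards [self_mem_nhdsWithin] with δ hδ using key δ hδ)

theorem exists_classicalSolution (hT : 0 < T) (hr : ∀ i, 0 ≤ r i) (hσ : ∀ i, IsUnit (σ i))
    (hΛ : IsRateMatrix Λ) (hK_lip : ∃ L : ℝ≥0, LipschitzOnWith L K (orthant d)) :
    ∃ φ ∈ classV d k T, IsClassicalSolution T r σ Λ K φ := by
  have hKc : ContinuousOn K (orthant d) := by
    obtain ⟨L, hL⟩ := hK_lip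
    exact hL.continuousOn
  obtain ⟨A, hA, hKA⟩ := exists_linear_growth hK_lip
  have hi := integrable_scaledPayoff hKc hA hKA
  obtain ⟨m, hmc, hmi, hm1, hml, hmu⟩ := exists_fourier_mollifier hi
    (uniformContinuous_scaledPayoff hKc hA hKA)
  set H := 𝓕 (scaledPayoff K)
  have hH : Continuous H := continuous_fourier hi
  set D := ∫ x, ‖scaledPayoff K x‖
  have hD : ∀ ξ, ‖H ξ‖ ≤ D := norm_fourier_le _
  have hHn : ∀ n, Continuous fun ξ => m n ξ * H ξ := fun n => (hmc n).mul hH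
  have hHi : ∀ n, Integrable fun ξ => m n ξ * H ξ := fun n =>
    (hmi n).mul_bdd (c := D) hH.aestronglyMeasurable (Eventually.of_forall hD)
  have hDn : ∀ n ξ, ‖m n ξ * H ξ‖ ≤ D := fun n ξ => by
    rw [norm_mul]
    exact (mul_le_of_le_one_left (norm_nonneg _) (hm1 n ξ)).trans (hD ξ)
  -- `H` need not be integrable, so the integral formula is meaningful only for `t < T`; the
  -- terminal value is imposed by hand, and continuity there comes from the approximations.
  set φ : ℝ → (Fin d → ℝ) → Fin k → ℝ := fun t =>
    if t < T then fullSol T r σ Λ H t else fun s _ => K s with hφ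
  have hφeq : ∀ t ∈ Ioo 0 T, φ t = fullSol T r σ Λ H t := fun t ht => by simp [hφ, ht.2]
  have hφT : ∀ s i, φ T s i = K s := fun s i => by simp [hφ]
  obtain ⟨hcont, M, hM⟩ := continuous_and_growth_of_tendsto (r := r) (σ := σ) (Λ := Λ) (K := K)
    (u := fun n => fullSol T r σ Λ fun ξ => m n ξ * H ξ) (φ := φ) hT hr hΛ hA hKA
    (fun n => isSol_fullSol r Λ hσ (hHn n) (hHi n) (hDn n))
    (fun n => exists_fullSol_bound r Λ hσ (hHi n))
    (fun t ht s i => by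
      rw [hφeq t ht]
      exact tendsto_finsetSum _ fun ε _ => tendsto_modeSol r Λ _ hσ hH hD hmc hm1 hml ht s i)
    hφT
    (fun δ hδ => by
      filter_upwards [hmu δ hδ] with n hn s hs i
      exact abs_fullSol_terminal_sub_le r Λ hn hs i)
  have hC12 := (isC12_fullSol (T := T) r Λ hσ hH hD).hasC12
  refine ⟨φ, ⟨fun i => (hcont i).mono (prod_mono Ioo_subset_Ioc_self subset_rfl), M, ?_⟩,
    (hC12.congr hφeq).isC12, hcont, fun t ht s hs i => ?_, fun s _ i => hφT s i⟩
  · rintro y ⟨t, ht, s, hs, i, rfl⟩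
    have hsum : ∑ l, |s l| = ∑ l, s l := Finset.sum_congr rfl fun l _ => abs_of_pos (hs l)
    have hpos : 0 < 1 + ∑ l, s l :=
      add_pos_of_pos_of_nonneg one_pos (Finset.sum_nonneg fun l _ => (hs l).le)
    rw [hsum, abs_div, abs_of_pos hpos, div_le_iff₀ hpos]
    exact hM t ht s hs i
  · rw [hC12.pde_congr hφeq r σ Λ ht hs]
    exact fullSol_pde r Λ hσ hH hD ht hs i

theorem exists_growth_of_mem_classV {φ : ℝ → (Fin d → ℝ) → Fin k → ℝ} (hφ : φ ∈ classV d k T) :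
    ∃ B, ∀ t ∈ Ioo 0 T, ∀ s ∈ orthant d, ∀ i, |φ t s i| ≤ B * barrier 2 s := by
  obtain ⟨M, hM⟩ := hφ.2
  refine ⟨|M| * 2 ^ d, fun t ht s hs i => ?_⟩
  have h1 := hM ⟨t, ht, s, hs, i, rfl⟩
  have hsum : ∑ l, |s l| = ∑ l, s l := Finset.sum_congr rfl fun l _ => abs_of_pos (hs l)
  have hpos : 0 < 1 + ∑ l, s l :=
    add_pos_of_pos_of_nonneg one_pos (Finset.sum_nonneg fun l _ => (hs l).le)
  rw [hsum, abs_div, abs_of_pos hpos, div_le_iff₀ hpos] at h1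
  calc |φ t s i| ≤ M * (1 + ∑ l, s l) := h1
    _ ≤ |M| * (1 + ∑ l, s l) := by gcongr; exact le_abs_self M
    _ ≤ |M| * (2 ^ d * barrier 2 s) := by gcongr; exact one_add_sum_le_barrier hs
    _ = _ := by ring

/-- The difference solves the equation with zero terminal value and is bounded above by a multiple
of `barrier 2`, so comparison with `A = δ = 0` applies. -/
theorem le_of_isClassicalSolution (hr : ∀ i, 0 ≤ r i) (hΛ : IsRateMatrix Λ)
    {φ ψ : ℝ → (Fin d → ℝ) → Fin k → ℝ} (hφV : φ ∈ classV d k T) (hψV : ψ ∈ classV d k T)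
    (hφ : IsClassicalSolution T r σ Λ K φ) (hψ : IsClassicalSolution T r σ Λ K ψ)
    {t : ℝ} (ht : t ∈ Ioc 0 T) {s : Fin d → ℝ} (hs : s ∈ orthant d) (i : Fin k) :
    φ t s i ≤ ψ t s i := by
  obtain ⟨G, -, hG⟩ := exists_comparison_linear_barrier hr hΛ T σ
  obtain ⟨B, hB⟩ := exists_growth_of_mem_classV hφV
  obtain ⟨B', hB'⟩ := exists_growth_of_mem_classV hψV
  have := hG 0 0 le_rfl le_rfl (φ - ψ) (hφ.isSol.sub hψ.isSol)
    ⟨B + B', fun t ht s hs i => by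
      have h1 := abs_le.1 (hB t ht s hs i)
      have h2 := abs_le.1 (hB' t ht s hs i)
      simp only [Pi.sub_apply]
      rw [add_mul]
      linarith [h1.2, h2.1]⟩
    (fun s hs i => by simp [hφ.terminal s hs i, hψ.terminal s hs i]) t ht s hs i
  simp only [Pi.sub_apply, zero_mul, add_zero, mul_zero] at this
  linarith

end existence

end RegimeSwitching

theorem theorem3p12 {d k : ℕ} {T : ℝ} (hT : 0 < T)
    (r : Fin k → ℝ) (hr : ∀ i, 0 ≤ r i)
    (σ : Fin k → Matrix (Fin d) (Fin d) ℝ) (hσ : ∀ i, IsUnit (σ i))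
    (Λ : Matrix (Fin k) (Fin k) ℝ) (hΛ : RegimeSwitching.IsRateMatrix Λ)
    (K : (Fin d → ℝ) → ℝ)
    (hK_nonneg : ∀ s ∈ RegimeSwitching.orthant d, 0 ≤ K s)
    (hK_lip : ∃ L : ℝ≥0, LipschitzOnWith L K (RegimeSwitching.orthant d)) :
    (∃ φ ∈ RegimeSwitching.classV d k T,
        RegimeSwitching.IsClassicalSolution T r σ Λ K φ) ∧
      ∀ φ ∈ RegimeSwitching.classV d k T, ∀ ψ ∈ RegimeSwitching.classV d k T,
        RegimeSwitching.IsClassicalSolution T r σ Λ K φ →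
        RegimeSwitching.IsClassicalSolution T r σ Λ K ψ →
        ∀ t ∈ Set.Ioc 0 T, ∀ s ∈ RegimeSwitching.orthant d, ∀ i, φ t s i = ψ t s i :=
  ⟨RegimeSwitching.exists_classicalSolution hT hr hσ hΛ hK_lip,
    fun _ hφV _ hψV hφ hψ _ ht _ hs i => le_antisymm
      (RegimeSwitching.le_of_isClassicalSolution hr hΛ hφV hψV hφ hψ ht hs i)
      (RegimeSwitching.le_of_isClassicalSolution hr hΛ hψV hφV hψ hφ ht hs i)⟩
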